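/- Let $A=(A_{ij})_{i,j\ge 0}$ be the infinite real matrix with $$A_{00}=\tfrac12,\quad A_{01}=-1,\quad A_{0j}=0\ (j\ge 2),$$ $$A_{10}=\frac{\pi^2}{12}+\sum_{k\ge1}\frac{(-1)^k}{k^22^k}-\frac{\log 2}{2},\quad A_{11}=\tfrac12+\log 2,\quad A_{1,k+1}=\frac1k+\frac{(-1)^k}{2^{k+1}}-\frac1{k2^k}\ (k\ge1),$$ and, for $r,k\ge 1$, $$A_{r+1,0}=\frac{(-1)^r}{r}\sum_{j\ge r}\frac1{j3^j},\quad A_{r+1,1}=0,\quad A_{r+1,k+1}=\binom kr\Big(\frac{(-1)^{k-r}}{2^{k+1}}-\frac1{k2^k}\Big),$$ where $\binom kr=0$ for $k<r$. It defines a bounded operator on real $\ell^1$ (column vectors). Let $A_m$ be its leading $(m+1)\times(m+1)$ block. For every $m\ge 7$ there is exactly one triple $(\lambda_m,v_m,w_m)$ such that $\lambda_m$ is a real eigenvalue of $A_m$ strictly larger in modulus than all its other complex eigenvalues, and $A_mv_m=\lambda_mv_m$, $w_mA_m=\lambda_mw_m$ with $(v_m)_0=(w_m)_0=1$. After padding by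 zeros, the limits $\lambda=\lim\lambda_m$, $v=\lim v_m$ (in $\ell^1$) and $w=\lim w_m$ (in $\ell^\infty$) exist. Moreover $\lambda>0$, $Av=\lambda v$, $wA=\lambda w$, every complex eigenvalue $z\neq\lambda$ of $A$ with an eigenvector in complex $\ell^1$ satisfies $|z|<\lambda$, and $\zeta:=wv=\sum_i w_iv_i\neq0$. If $u\in\ell^1$ satisfies $wu=\sum_i w_iu_i\ne 0$, then, in the $\ell^1$ norm, $$\lim_{n\to\infty}\lambda^{-n}A^nu=\frac{(wu)\,v}{\zeta}\qquad\text{and}\qquad \lim_{n\to\infty}\frac{A^nu}{\|A^nu\|}=\frac{(wu)\,v}{\|(wu)\,v\|}.$$ -/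

import Mathlib

open Filter Topology
open scoped ENNReal

noncomputable section

/-- The Banach space of real sequences `(ℓ, a₀, a₁, …)` with the `ℓ¹` norm (column vectors). -/
abbrev EllOne : Type := lp (fun _ : ℕ => ℝ) 1

/-- The Banach space of bounded real sequences with the sup norm (row vectors). -/
abbrev EllInf : Type := lp (fun _ : ℕ => ℝ) ∞

/-- The infinite matrix of the parking transform acting on the coefficients `(ℓ, a₀, a₁, …)` of
`ℓ log t + ∑ aₖ (t - 1)ᵏ`. Index `0` stands for `ℓ` and index `k + 1` for `aₖ`.
In the last clause the row is the one of `a_{r+1}` and the column the one of `a_{k+1}`; the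
exponent `k + r` has the parity of `k - r`, and the binomial coefficient vanishes for `k < r`. -/
def parkMatrix : ℕ → ℕ → ℝ
  | 0, 0 => 1 / 2
  | 0, 1 => -1
  | 0, _ + 2 => 0
  | 1, 0 => Real.pi ^ 2 / 12
      + (∑' k : ℕ, (-1 : ℝ) ^ (k + 1) / (((k : ℝ) + 1) ^ 2 * 2 ^ (k + 1))) - Real.log 2 / 2
  | 1, 1 => 1 / 2 + Real.log 2
  | 1, k + 2 => 1 / ((k : ℝ) + 1) + (-1 : ℝ) ^ (k + 1) / 2 ^ (k + 2)
      - 1 / (((k : ℝ) + 1) * 2 ^ (k + 1))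
  | r + 2, 0 => (-1 : ℝ) ^ (r + 1) / ((r : ℝ) + 1)
      * ∑' j : ℕ, 1 / (((j : ℝ) + r + 1) * 3 ^ (j + r + 1))
  | _ + 2, 1 => 0
  | r + 2, k + 2 => ((k + 1).choose (r + 1) : ℝ)
      * ((-1 : ℝ) ^ (k + r) / 2 ^ (k + 2) - 1 / (((k : ℝ) + 1) * 2 ^ (k + 1)))

/-- The leading `(m + 1) × (m + 1)` block. -/
def parkBlock (m : ℕ) : Matrix (Fin (m + 1)) (Fin (m + 1)) ℝ :=
  Matrix.of fun i j => parkMatrix i j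

/-- `μ` is the eigenvalue of maximum modulus of the block of size `m + 1`, every other complex
eigenvalue being strictly smaller in modulus, and `v`, `w` are the right and left eigenvectors
for `μ` whose entries of index `0` are equal to `1`. -/
structure IsPrincipalTriple (m : ℕ) (μ : ℝ) (v w : Fin (m + 1) → ℝ) : Prop where
  right_eigen : (parkBlock m).mulVec v = μ • v
  left_eigen : Matrix.vecMul w (parkBlock m) = μ • w
  right_zero : v 0 = 1
  left_zero : w 0 = 1
  dominant : ∀ z : ℂ, z ∈ spectrum ℂ ((parkBlock m).map (algebraMap ℝ ℂ)) →
    z ≠ (μ : ℂ) → ‖z‖ < |μ|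

/-- A finite vector, padded by zeros to an element of `ℓᵖ`. -/
def padZero (p : ℝ≥0∞) {m : ℕ} (x : Fin (m + 1) → ℝ) : lp (fun _ : ℕ => ℝ) p :=
  ∑ i : Fin (m + 1), lp.single p (i : ℕ) (x i)

/-- The product `w u` of a bounded row vector and a summable column vector. -/
def rowMul (w : EllInf) (u : EllOne) : ℝ := ∑' i : ℕ, w i * u i

theorem ellOne_summable (u : EllOne) : Summable fun j => |u j| := by
  have h := lp.memℓp u
  simpa using (memℓp_gen_iff (p := 1) (by simp)).1 h

theorem ellOne_norm (u : EllOne) : ‖u‖ = ∑' j, |u j| := by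
  simpa using lp.norm_eq_tsum_rpow (p := 1) (by simp) u

theorem ellOne_mk_norm {f : ℕ → ℝ} (h : Memℓp f 1) :
    ‖(⟨f, h⟩ : EllOne)‖ = ∑' j, |f j| := ellOne_norm _

theorem abs_tail_le (r : ℕ) :
    |(-1 : ℝ) ^ (r + 1) / ((r : ℝ) + 1)
      * ∑' j : ℕ, 1 / (((j : ℝ) + r + 1) * 3 ^ (j + r + 1))| ≤ 2 * (1 / 3 : ℝ) ^ r := by
  have hterm : ∀ j : ℕ, 1 / (((j : ℝ) + r + 1) * 3 ^ (j + r + 1)) ≤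
      (1 / 3 : ℝ) ^ r * (1 / 3 : ℝ) ^ j := by
    intro j
    rw [← pow_add, one_div_pow]
    apply one_div_le_one_div_of_le (by positivity)
    have h1 : (1 : ℝ) ≤ (j : ℝ) + r + 1 := by
      have : (0 : ℝ) ≤ (j : ℝ) + r := by positivity
      linarith
    have h2 : (3 : ℝ) ^ (r + j) ≤ 3 ^ (j + r + 1) :=
      pow_le_pow_right₀ (by norm_num) (by omega)
    calc (3 : ℝ) ^ (r + j) ≤ 1 * 3 ^ (j + r + 1) := by simpa using h2
      _ ≤ _ := by gcongr
  have hg : HasSum (fun j : ℕ => (1 / 3 : ℝ) ^ r * (1 / 3 : ℝ) ^ j)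
      ((1 / 3 : ℝ) ^ r * (1 - 1 / 3)⁻¹) :=
    (hasSum_geometric_of_lt_one (by norm_num) (by norm_num)).mul_left _
  have hs : Summable fun j : ℕ => 1 / (((j : ℝ) + r + 1) * 3 ^ (j + r + 1)) :=
    Summable.of_nonneg_of_le (fun j => by positivity) hterm hg.summable
  have ht := hs.tsum_le_tsum hterm hg.summable
  rw [hg.tsum_eq] at ht
  have h0 : 0 ≤ ∑' j : ℕ, 1 / (((j : ℝ) + r + 1) * 3 ^ (j + r + 1)) :=
    tsum_nonneg fun j => by positivity
  rw [abs_mul, abs_div, abs_pow, abs_neg, abs_one, one_pow, abs_of_nonneg h0,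
    abs_of_pos (by positivity : (0 : ℝ) < (r : ℝ) + 1)]
  have hr : 1 / ((r : ℝ) + 1) ≤ 1 := by
    rw [div_le_one (by positivity)]
    have : (0 : ℝ) ≤ r := by positivity
    linarith
  have hp : (0 : ℝ) ≤ (1 / 3) ^ r := by positivity
  calc _ ≤ 1 * ∑' j : ℕ, 1 / (((j : ℝ) + r + 1) * 3 ^ (j + r + 1)) := by gcongr
    _ ≤ _ := by linarith

theorem summable_parkMatrix_col (j : ℕ) : Summable fun i => |parkMatrix i j| := by
  match j with
  | 0 =>
    rw [← summable_nat_add_iff 2]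
    exact Summable.of_nonneg_of_le (fun _ => abs_nonneg _) abs_tail_le
      ((summable_geometric_of_lt_one (by norm_num) (by norm_num)).mul_left 2)
  | 1 =>
    rw [← summable_nat_add_iff 2]
    simp [parkMatrix]
  | k + 2 =>
    refine summable_of_ne_finset_zero (s := Finset.range (k + 3)) fun i hi => ?_
    obtain ⟨r, rfl⟩ : ∃ r, i = r + 2 := ⟨i - 2, by simp at hi; omega⟩
    simp at hi
    have : (k + 1).choose (r + 1) = 0 := Nat.choose_eq_zero_of_lt (by omega)
    simp [parkMatrix, this]

theorem tsum_parkMatrix_col_le (k : ℕ) : ∑' i, |parkMatrix i (k + 2)| ≤ 5 := by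
  have hs := summable_parkMatrix_col (k + 2)
  rw [← hs.sum_add_tsum_nat_add 2]
  have hk : (1 : ℝ) ≤ (k : ℝ) + 1 := by
    have : (0 : ℝ) ≤ k := by positivity
    linarith
  have hk1 : 1 / ((k : ℝ) + 1) ≤ 1 := by rw [div_le_one (by positivity)]; exact hk
  have h2 : (1 : ℝ) ≤ 2 ^ (k + 1) := one_le_pow₀ (by norm_num)
  have hb : 1 / (((k : ℝ) + 1) * 2 ^ (k + 1)) ≤ 1 / 2 ^ (k + 1) := by
    apply one_div_le_one_div_of_le (by positivity)
    nlinarith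
  have hpow : (2 : ℝ) ^ (k + 2) = 2 * 2 ^ (k + 1) := by ring
  have hq : 1 / (2 : ℝ) ^ (k + 1) ≤ 1 := by rw [div_le_one (by positivity)]; exact h2
  have hq0 : 0 ≤ 1 / (2 : ℝ) ^ (k + 1) := by positivity
  have hc : 1 / (2 : ℝ) ^ (k + 2) = 1 / 2 * (1 / 2 ^ (k + 1)) := by rw [hpow]; field_simp
  have hfirst : ∑ i ∈ Finset.range 2, |parkMatrix i (k + 2)| ≤ 5 / 2 + 1 / 2 := by
    simp only [Finset.sum_range_succ, Finset.sum_range_zero, parkMatrix, abs_zero, zero_add]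
    have ha : |(-1 : ℝ) ^ (k + 1) / 2 ^ (k + 2)| = 1 / 2 ^ (k + 2) := by
      rw [abs_div, abs_pow, abs_neg, abs_one, one_pow, abs_of_pos (by positivity)]
    have ha' := abs_le.1 ha.le
    have hn1 : 0 ≤ 1 / ((k : ℝ) + 1) := by positivity
    have hn2 : 0 ≤ 1 / (((k : ℝ) + 1) * 2 ^ (k + 1)) := by positivity
    rw [abs_le]
    constructor <;> linarith [ha'.1, ha'.2]
  have htail : ∑' i, |parkMatrix (i + 2) (k + 2)| ≤ 2 := by
    rw [tsum_eq_sum (s := Finset.range (k + 1)) (fun r hr => by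
      have : (k + 1).choose (r + 1) = 0 := Nat.choose_eq_zero_of_lt (by simp at hr; omega)
      simp [parkMatrix, this])]
    have hterm : ∀ r ∈ Finset.range (k + 1), |parkMatrix (r + 2) (k + 2)| ≤
        ((k + 1).choose (r + 1) : ℝ) * (3 / 2 * (1 / 2 ^ (k + 1))) := by
      intro r _
      simp only [parkMatrix]
      rw [abs_mul, abs_of_nonneg (by positivity : (0 : ℝ) ≤ ((k + 1).choose (r + 1) : ℝ))]
      gcongr
      have ha : |(-1 : ℝ) ^ (k + r) / 2 ^ (k + 2)| = 1 / 2 ^ (k + 2) := by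
        rw [abs_div, abs_pow, abs_neg, abs_one, one_pow, abs_of_pos (by positivity)]
      have ha' := abs_le.1 ha.le
      have hn2 : 0 ≤ 1 / (((k : ℝ) + 1) * 2 ^ (k + 1)) := by positivity
      rw [abs_le]
      constructor <;> linarith [ha'.1, ha'.2]
    refine (Finset.sum_le_sum hterm).trans ?_
    rw [← Finset.sum_mul]
    have hch : ∑ r ∈ Finset.range (k + 1), ((k + 1).choose (r + 1) : ℝ) ≤ 2 ^ (k + 1) := by
      have h := Nat.sum_range_choose (k + 1)
      rw [Finset.sum_range_succ'] at h
      have h' : ∑ r ∈ Finset.range (k + 1), (k + 1).choose (r + 1) ≤ 2 ^ (k + 1) := by omega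
      exact_mod_cast h'
    calc _ ≤ (2 : ℝ) ^ (k + 1) * (3 / 2 * (1 / 2 ^ (k + 1))) := by gcongr
      _ = 3 / 2 := by field_simp
      _ ≤ 2 := by norm_num
  linarith

/-- The columns of the matrix, as elements of `ℓ¹`. -/
def parkCol (j : ℕ) : EllOne :=
  ⟨fun i => parkMatrix i j,
    (memℓp_gen_iff (p := 1) (by simp)).2 (by simpa using summable_parkMatrix_col j)⟩

theorem parkCol_norm_le (j : ℕ) : ‖parkCol j‖ ≤ max 5 (max ‖parkCol 0‖ ‖parkCol 1‖) := by
  match j with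
  | 0 => exact (le_max_left _ _).trans (le_max_right _ _)
  | 1 => exact (le_max_right _ _).trans (le_max_right _ _)
  | k + 2 =>
    refine le_trans ?_ (le_max_left _ _)
    exact (ellOne_mk_norm _).le.trans (tsum_parkMatrix_col_le k)

theorem summable_norm_smul_parkCol (u : EllOne) : Summable fun j => ‖u j • parkCol j‖ := by
  refine Summable.of_nonneg_of_le (fun _ => norm_nonneg _) (fun j => ?_)
    ((ellOne_summable u).mul_right (max 5 (max ‖parkCol 0‖ ‖parkCol 1‖)))
  rw [norm_smul, Real.norm_eq_abs]
  exact mul_le_mul_of_nonneg_left (parkCol_norm_le j) (abs_nonneg _)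

/-- The bounded operator on `ℓ¹` given by the matrix, `u ↦ ∑ⱼ uⱼ · (column j)`. Its coordinates
are the usual ones, see `parkOp_hasSum`. -/
def parkOp : EllOne →L[ℝ] EllOne :=
  LinearMap.mkContinuous
    { toFun := fun u => ∑' j, u j • parkCol j
      map_add' := fun u u' => by
        rw [← (summable_norm_smul_parkCol u).of_norm.tsum_add
          (summable_norm_smul_parkCol u').of_norm]
        exact tsum_congr fun j => by rw [lp.coeFn_add, Pi.add_apply, add_smul]
      map_smul' := fun c u => by
        rw [RingHom.id_apply, ← (summable_norm_smul_parkCol u).of_norm.tsum_const_smul c]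
        exact tsum_congr fun j => by
          rw [lp.coeFn_smul, Pi.smul_apply, smul_eq_mul, mul_smul] }
    (max 5 (max ‖parkCol 0‖ ‖parkCol 1‖)) fun u => by
      refine (norm_tsum_le_tsum_norm (summable_norm_smul_parkCol u)).trans ?_
      rw [mul_comm, ellOne_norm u, ← tsum_mul_right]
      refine (summable_norm_smul_parkCol u).tsum_le_tsum (fun j => ?_)
        ((ellOne_summable u).mul_right _)
      rw [norm_smul, Real.norm_eq_abs]
      exact mul_le_mul_of_nonneg_left (parkCol_norm_le j) (abs_nonneg _)

theorem parkOp_hasSum (u : EllOne) (i : ℕ) :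
    HasSum (fun j => parkMatrix i j * u j) (parkOp u i) := by
  have h := ((summable_norm_smul_parkCol u).of_norm.hasSum).mapL
    (lp.evalCLM ℝ (fun _ : ℕ => ℝ) 1 i)
  have e : (fun j => parkMatrix i j * u j) =
      fun j => lp.evalCLM ℝ (fun _ : ℕ => ℝ) 1 i (u j • parkCol j) := by
    funext j
    rw [mul_comm]
    rfl
  rw [e]
  exact h

/-- `x` is an eigenvector in complex `ℓ¹`, with eigenvalue `z`, of the infinite matrix. -/
def IsComplexEigen (z : ℂ) (x : ℕ → ℂ) : Prop :=
  x ≠ 0 ∧ (Summable fun j => ‖x j‖) ∧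
    ∀ i, HasSum (fun j => (parkMatrix i j : ℂ) * x j) (z * x i)

end

/-!
Perron–Frobenius without positivity. Let `φ x = x₁`. On the hyperplane `φ = 0` the operator `T`
stretches a norm equivalent to the `ℓ¹` norm by at most a factor `q`, and the projective map
`x ↦ T x / φ (T x)` moves an explicit vector `v₀` with `φ v₀ = 1` by little, while `φ ∘ T` stays
above some `l > q` on a small ball around `v₀` in the hyperplane `φ = 1`. Hence the projective map
is a `q / l`-contraction of this ball. Its fixed point is the right eigenvector `v`, with eigenvalue
`μ = φ (T v)`, and `Tⁿ x - φ (Tⁿ x) • v` is `O(qⁿ)`. Therefore the functionals `μ⁻ⁿ • φ ∘ Tⁿ`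
converge geometrically, to the left eigenvector `w`, and `Tⁿ x = μⁿ (w x) v + O(qⁿ)`.

The same ball and the same constants serve for all blocks of the matrix of order at least `5`,
regarded as operators on `ℓ¹`. The estimates being uniform, the eigendata of the blocks converge to
those of `T`; for the left eigenvectors in `ℓ^∞` this needs norm convergence of the functionals,
which holds because the entries of each row of the matrix tend to `0`.
-/

section SpectralGap

variable {E F : Type*} [NormedAddCommGroup E] [NormedSpace ℝ E]
  [NormedAddCommGroup F] [NormedSpace ℝ F]

/-- A simple dominant eigenvalue `μ` with right and left eigenvectors `v` and `w`, normalized by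
`w v = 1`: after removing the rank one operator `μ ^ n • (w · • v)` from `T ^ n`, what remains is
`O(q ^ n)` with `q < μ`. -/
structure HasSpectralGap (T : E →L[ℝ] E) (q μ : ℝ) (v : E) (w : E →L[ℝ] ℝ) : Prop where
  rate_nonneg : 0 ≤ q
  rate_lt : q < μ
  right_eigen : T v = μ • v
  left_eigen : ∀ x, w (T x) = μ * w x
  pairing : w v = 1
  bound : ∃ C, ∀ n x, ‖(T ^ n) x - (μ ^ n * w x) • v‖ ≤ C * q ^ n * ‖x‖

theorem le_of_forall_pow_mul_le_pow_mul {x y c d : ℝ} (hy : 0 ≤ y) (hc : 0 < c)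
    (h : ∀ n : ℕ, x ^ n * c ≤ y ^ n * d) : x ≤ y := by
  by_contra! hlt
  have hx : 0 < x := hy.trans_lt hlt
  have hlim : Tendsto (fun n : ℕ => (y / x) ^ n * d) atTop (𝓝 0) := by
    simpa using (tendsto_pow_atTop_nhds_zero_of_lt_one (div_nonneg hy hx.le)
      ((div_lt_one hx).2 hlt)).mul_const d
  refine hc.not_ge (ge_of_tendsto' hlim fun n => ?_)
  rw [div_pow, div_mul_eq_mul_div, le_div_iff₀ (pow_pos hx n), mul_comm]
  exact h n

theorem inv_norm_smul_smul {c : ℝ} (hc : 0 < c) (x : E) :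
    ‖c • x‖⁻¹ • (c • x) = ‖x‖⁻¹ • x := by
  rw [norm_smul, Real.norm_of_nonneg hc.le, mul_inv, smul_smul, mul_right_comm,
    inv_mul_cancel₀ hc.ne', one_mul]

theorem tendsto_normalize_of_tendsto {x : ℕ → E} {y : E} {μ : ℝ} (hμ : 0 < μ) (hy : y ≠ 0)
    (h : Tendsto (fun n => (μ ^ n)⁻¹ • x n) atTop (𝓝 y)) :
    Tendsto (fun n => ‖x n‖⁻¹ • x n) atTop (𝓝 (‖y‖⁻¹ • y)) :=
  ((h.norm.inv₀ (norm_ne_zero_iff.2 hy)).smul h).congr fun n =>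
    inv_norm_smul_smul (inv_pos.2 (pow_pos hμ n)) (x n)

theorem pow_apply_of_apply_eq_smul {T : E →L[ℝ] E} {μ : ℝ} {x : E} (hx : T x = μ • x) (n : ℕ) :
    (T ^ n) x = μ ^ n • x := by
  induction n with
  | zero => simp
  | succ n ih => rw [pow_succ', mul_apply_eq_comp, ih, map_smul, hx, smul_smul, pow_succ]

theorem functional_pow_apply {T : E →L[ℝ] E} {μ : ℝ} {w : E →L[ℝ] ℝ}
    (hw : ∀ x, w (T x) = μ * w x) (n : ℕ) (x : E) : w ((T ^ n) x) = μ ^ n * w x := by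
  induction n with
  | zero => simp
  | succ n ih => rw [pow_succ', mul_apply_eq_comp, hw, ih, pow_succ', mul_assoc]

theorem pow_apply_of_complex_eigen {T : E →L[ℝ] E} {z : ℂ} {a b : E}
    (ha : T a = z.re • a - z.im • b) (hb : T b = z.im • a + z.re • b) (n : ℕ) :
    (T ^ n) a = (z ^ n).re • a - (z ^ n).im • b ∧
      (T ^ n) b = (z ^ n).im • a + (z ^ n).re • b := by
  induction n with
  | zero => simp
  | succ n ih =>
    rw [pow_succ' T, mul_apply_eq_comp, mul_apply_eq_comp, ih.1, ih.2, pow_succ z]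
    simp only [map_sub, map_add, map_smul, ha, hb, Complex.mul_re, Complex.mul_im]
    constructor <;> module

theorem pow_norm_mul_norm_le_of_complex_eigen {T : E →L[ℝ] E} {z : ℂ} {a b : E}
    (ha : T a = z.re • a - z.im • b) (hb : T b = z.im • a + z.re • b) (n : ℕ) :
    ‖z‖ ^ n * ‖a‖ ≤ ‖(T ^ n) a‖ + ‖(T ^ n) b‖ := by
  obtain ⟨hna, hnb⟩ := pow_apply_of_complex_eigen ha hb n
  rw [← norm_pow]
  set c := z ^ n
  rcases eq_or_ne c 0 with hc | hc
  · rw [hc, norm_zero, zero_mul]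
    positivity
  have hrotate : (‖c‖ * ‖c‖) • a = c.re • (T ^ n) a + c.im • (T ^ n) b := by
    rw [hna, hnb, Complex.norm_mul_self_eq_normSq, Complex.normSq_apply]
    module
  refine le_of_mul_le_mul_left ?_ (norm_pos_iff.2 hc)
  calc ‖c‖ * (‖c‖ * ‖a‖) = ‖(‖c‖ * ‖c‖) • a‖ := by
        rw [norm_smul, norm_mul, norm_norm, mul_assoc]
    _ ≤ |c.re| * ‖(T ^ n) a‖ + |c.im| * ‖(T ^ n) b‖ := by
        rw [hrotate]
        exact (norm_add_le _ _).trans_eq (by simp only [norm_smul, Real.norm_eq_abs])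
    _ ≤ ‖c‖ * ‖(T ^ n) a‖ + ‖c‖ * ‖(T ^ n) b‖ := by
        gcongr
        exacts [Complex.abs_re_le_norm c, Complex.abs_im_le_norm c]
    _ = ‖c‖ * (‖(T ^ n) a‖ + ‖(T ^ n) b‖) := (mul_add _ _ _).symm

namespace HasSpectralGap

variable {T : E →L[ℝ] E} {q μ : ℝ} {v : E} {w : E →L[ℝ] ℝ}

theorem eigenvalue_pos (h : HasSpectralGap T q μ v w) : 0 < μ :=
  h.rate_nonneg.trans_lt h.rate_lt

theorem right_ne_zero (h : HasSpectralGap T q μ v w) : v ≠ 0 := by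
  rintro rfl
  simpa using h.pairing

theorem tendsto_pow_apply (h : HasSpectralGap T q μ v w) (x : E) :
    Tendsto (fun n : ℕ => (μ ^ n)⁻¹ • (T ^ n) x) atTop (𝓝 (w x • v)) := by
  have hμ := h.eigenvalue_pos
  obtain ⟨C, hC⟩ := h.bound
  rw [tendsto_iff_norm_sub_tendsto_zero]
  have hlim : Tendsto (fun n : ℕ => C * ‖x‖ * (q / μ) ^ n) atTop (𝓝 0) := by
    simpa using (tendsto_pow_atTop_nhds_zero_of_lt_one (div_nonneg h.rate_nonneg hμ.le)
      ((div_lt_one hμ).2 h.rate_lt)).const_mul (C * ‖x‖)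
  refine squeeze_zero (fun _ => norm_nonneg _) (fun n => ?_) hlim
  have hn : 0 < μ ^ n := by positivity
  have hfactor : (μ ^ n)⁻¹ • (T ^ n) x - w x • v
      = (μ ^ n)⁻¹ • ((T ^ n) x - (μ ^ n * w x) • v) := by
    rw [smul_sub, smul_smul, inv_mul_cancel_left₀ hn.ne']
  rw [hfactor, norm_smul, Real.norm_of_nonneg (by positivity), inv_mul_le_iff₀ hn, div_pow]
  refine (hC n x).trans_eq ?_
  field_simp

theorem right_unique (h : HasSpectralGap T q μ v w) {x : E} (hx : T x = μ • x) :
    x = w x • v := by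
  refine tendsto_nhds_unique (tendsto_const_nhds.congr fun n => ?_) (h.tendsto_pow_apply x)
  rw [pow_apply_of_apply_eq_smul hx, inv_smul_smul₀ (pow_ne_zero n h.eigenvalue_pos.ne')]

theorem left_unique (h : HasSpectralGap T q μ v w) {w' : E →L[ℝ] ℝ}
    (hw' : ∀ x, w' (T x) = μ * w' x) : w' = w' v • w := by
  ext x
  have hlim := (w'.continuous.tendsto _).comp (h.tendsto_pow_apply x)
  have hconst : Tendsto (fun _ : ℕ => w' x) atTop (𝓝 (w' (w x • v))) := by
    refine hlim.congr fun n => ?_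
    rw [Function.comp_apply, map_smul, functional_pow_apply hw', smul_eq_mul,
      inv_mul_cancel_left₀ (pow_ne_zero n h.eigenvalue_pos.ne')]
  rw [tendsto_nhds_unique tendsto_const_nhds hconst]
  simp [mul_comm]

theorem tendsto_pow_apply_of_eigenvectors (h : HasSpectralGap T q μ v w) {v' : E}
    {w' : E →L[ℝ] ℝ} (hv' : T v' = μ • v') (hw' : ∀ x, w' (T x) = μ * w' x) (hpair : w' v' ≠ 0)
    (x : E) : Tendsto (fun n : ℕ => (μ ^ n)⁻¹ • (T ^ n) x) atTop (𝓝 ((w' x / w' v') • v')) := by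
  obtain ⟨c, rfl⟩ : ∃ c : ℝ, w' = c • w := ⟨_, h.left_unique hw'⟩
  obtain ⟨d, rfl⟩ : ∃ d : ℝ, v' = d • v := ⟨_, h.right_unique hv'⟩
  simp only [smul_apply, map_smul, h.pairing, smul_eq_mul, mul_one] at hpair ⊢
  obtain ⟨hd, hc⟩ := mul_ne_zero_iff.1 hpair
  rw [smul_smul, mul_comm d, mul_div_mul_left _ _ hc, div_mul_cancel₀ _ hd]
  exact h.tendsto_pow_apply x

theorem tendsto_normalize_pow_apply (h : HasSpectralGap T q μ v w) {v' : E} {w' : E →L[ℝ] ℝ}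
    (hv' : T v' = μ • v') (hw' : ∀ x, w' (T x) = μ * w' x) (hpair : 0 < w' v') {x : E}
    (hx : w' x ≠ 0) :
    Tendsto (fun n : ℕ => ‖(T ^ n) x‖⁻¹ • (T ^ n) x) atTop
      (𝓝 (‖w' x • v'‖⁻¹ • (w' x • v'))) := by
  have hv₀ : v' ≠ 0 := by
    rintro rfl
    exact hpair.ne (map_zero w').symm
  have hlim := tendsto_normalize_of_tendsto h.eigenvalue_pos
    (smul_ne_zero (div_ne_zero hx hpair.ne') hv₀)
    (h.tendsto_pow_apply_of_eigenvectors hv' hw' hpair.ne' x)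
  rwa [div_eq_inv_mul, mul_smul, inv_norm_smul_smul (inv_pos.2 hpair)] at hlim

theorem apply_eq_zero_of_complex_eigen (h : HasSpectralGap T q μ v w) {z : ℂ} {a b : E}
    (ha : T a = z.re • a - z.im • b) (hb : T b = z.im • a + z.re • b) (hz : z ≠ μ) :
    w a = 0 ∧ w b = 0 := by
  have hwa := (h.left_eigen a).symm.trans (congrArg w ha)
  have hwb := (h.left_eigen b).symm.trans (congrArg w hb)
  simp only [map_sub, map_add, map_smul, smul_eq_mul] at hwa hwb
  have hmul : ((μ : ℂ) - z) * (⟨w a, w b⟩ : ℂ) = 0 := by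
    apply Complex.ext <;> simp <;> linarith
  have hzero := (mul_eq_zero.1 hmul).resolve_left (sub_ne_zero.2 hz.symm)
  exact ⟨congrArg Complex.re hzero, congrArg Complex.im hzero⟩

theorem norm_le_of_complex_eigen_of_ne (h : HasSpectralGap T q μ v w) {z : ℂ} {a b : E}
    (ha₀ : a ≠ 0) (ha : T a = z.re • a - z.im • b) (hb : T b = z.im • a + z.re • b)
    (hz : z ≠ μ) : ‖z‖ ≤ q := by
  obtain ⟨hwa, hwb⟩ := h.apply_eq_zero_of_complex_eigen ha hb hz
  obtain ⟨C, hC⟩ := h.bound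
  have hdecay : ∀ {x}, w x = 0 → ∀ n, ‖(T ^ n) x‖ ≤ C * q ^ n * ‖x‖ := fun {x} hx n => by
    simpa [hx] using hC n x
  refine le_of_forall_pow_mul_le_pow_mul (c := ‖a‖) (d := C * (‖a‖ + ‖b‖)) h.rate_nonneg
    (norm_pos_iff.2 ha₀) fun n => ?_
  calc ‖z‖ ^ n * ‖a‖ ≤ ‖(T ^ n) a‖ + ‖(T ^ n) b‖ :=
        pow_norm_mul_norm_le_of_complex_eigen ha hb n
    _ ≤ C * q ^ n * ‖a‖ + C * q ^ n * ‖b‖ := add_le_add (hdecay hwa n) (hdecay hwb n)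
    _ = q ^ n * (C * (‖a‖ + ‖b‖)) := by ring

/-- Here `a + i b` is an eigenvector of the complexification of `T` for the eigenvalue `z`. -/
theorem norm_le_of_complex_eigen (h : HasSpectralGap T q μ v w) {z : ℂ} {a b : E}
    (hab : a ≠ 0 ∨ b ≠ 0) (ha : T a = z.re • a - z.im • b) (hb : T b = z.im • a + z.re • b)
    (hz : z ≠ μ) : ‖z‖ ≤ q := by
  rcases hab with ha₀ | hb₀
  · exact h.norm_le_of_complex_eigen_of_ne ha₀ ha hb hz
  · refine h.norm_le_of_complex_eigen_of_ne (b := -a) hb₀ ?_ ?_ hz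
    · rw [hb]; module
    · rw [map_neg, ha]; module

theorem of_factorization (h : HasSpectralGap T q μ v w) {A : F →L[ℝ] F} {J : F →L[ℝ] E}
    {R : E →L[ℝ] F} (hRJ : ∀ y, R (J y) = y) (hT : ∀ x, T x = J (A (R x))) :
    HasSpectralGap A q μ (R v) (w.comp J) := by
  have hTJ : ∀ y, T (J y) = J (A y) := fun y => by rw [hT, hRJ]
  have hJRv : J (R v) = v := by
    have hv : μ • J (R v) = μ • v := by
      rw [← map_smul, ← map_smul, ← h.right_eigen, hT, hRJ]
    exact smul_right_injective E h.eigenvalue_pos.ne' hv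
  have hpow : ∀ n y, (A ^ n) y = R ((T ^ n) (J y)) := fun n y => by
    induction n generalizing y with
    | zero => simp [hRJ]
    | succ n ih => rw [pow_succ A, pow_succ T, mul_apply_eq_comp, mul_apply_eq_comp, hTJ, ih]
  refine ⟨h.rate_nonneg, h.rate_lt, ?_, fun y => ?_, ?_, ?_⟩
  · rw [← map_smul, ← h.right_eigen, hT, hRJ]
  · rw [ContinuousLinearMap.comp_apply, ← hTJ, h.left_eigen, ContinuousLinearMap.comp_apply]
  · rw [ContinuousLinearMap.comp_apply, hJRv, h.pairing]
  · obtain ⟨C, hC⟩ := h.bound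
    refine ⟨‖R‖ * max C 0 * ‖J‖, fun n y => ?_⟩
    have hCn : C * q ^ n * ‖J y‖ ≤ max C 0 * q ^ n * (‖J‖ * ‖y‖) := by
      have := pow_nonneg h.rate_nonneg n
      gcongr
      exacts [le_max_left C 0, J.le_opNorm y]
    calc ‖(A ^ n) y - (μ ^ n * w (J y)) • R v‖
        = ‖R ((T ^ n) (J y) - (μ ^ n * w (J y)) • v)‖ := by rw [hpow, map_sub, map_smul]
      _ ≤ ‖R‖ * (max C 0 * q ^ n * (‖J‖ * ‖y‖)) :=
          (R.le_opNorm _).trans (by gcongr; exact (hC n (J y)).trans hCn)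
      _ = ‖R‖ * max C 0 * ‖J‖ * q ^ n * ‖y‖ := by ring

end HasSpectralGap

end SpectralGap

/-- The data of a Perron–Frobenius argument without positivity: a functional `φ` and a vector `e`
with `φ e = 1` along which the seminorm `p`, equivalent to the norm, splits as an `ℓ¹` sum, and a
ball of radius `δ` around `v₀` in the hyperplane `φ = 1`, contained in the `p`-ball of radius `p e`
around `e`. The numbers `q < l` bound the growth on `ker φ` and, from below, the eigenvalue. -/
structure ConeFrame (E : Type*) [NormedAddCommGroup E] [NormedSpace ℝ E] where
  p : Seminorm ℝ E
  φ : E →L[ℝ] ℝ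
  e : E
  v₀ : E
  q : ℝ
  l : ℝ
  δ : ℝ
  C : ℝ
  norm_le : ∀ x, ‖x‖ ≤ p x
  le_norm : ∀ x, p x ≤ C * ‖x‖
  φ_e : φ e = 1
  φ_v₀ : φ v₀ = 1
  split : ∀ x, p x = p (x - φ x • e) + |φ x| * p e
  q_pos : 0 < q
  q_lt_l : q < l
  δ_nonneg : 0 ≤ δ
  center : p (v₀ - e) + δ ≤ p e

namespace ConeFrame

variable {E : Type*} [NormedAddCommGroup E] [NormedSpace ℝ E] (F : ConeFrame E)

/-- The operator `T` stretches the seminorm by at most `q` on `ker φ`, and moves the centre `v₀` of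
the cone so little, while scaling it by so much, that the cone is mapped into itself. -/
structure Contracts (T : E →L[ℝ] E) : Prop where
  contr : ∀ k, F.φ k = 0 → F.p (T k) ≤ F.q * F.p k
  residual : F.p (T F.v₀ - F.φ (T F.v₀) • F.v₀) ≤ (F.l - F.q) * F.δ
  lower : F.l + F.q / F.p F.e * F.δ ≤ F.φ (T F.v₀)

/-- The section of the cone by the hyperplane `φ = 1`. -/
def base : Set E := {x | F.φ x = 1 ∧ F.p (x - F.v₀) ≤ F.δ}

/-- The projective action of `T` on the hyperplane `φ = 1`. -/
noncomputable def normalized (T : E →L[ℝ] E) (x : E) : E := (F.φ (T x))⁻¹ • T x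

/-- An eigenvector `v` in the cone, its eigenvalue `μ`, and the corresponding left eigenvector `w`,
obtained by iterating the transpose of `T` on `φ`. -/
structure IsPrincipal (T : E →L[ℝ] E) (μ : ℝ) (v : E) (w : E →L[ℝ] ℝ) : Prop where
  mem_base : v ∈ F.base
  le_eigenvalue : F.l ≤ μ
  right_eigen : T v = μ • v
  tendsto_left : Tendsto (fun n : ℕ => (μ ^ n)⁻¹ • F.φ.comp (T ^ n)) atTop (𝓝 w)

variable {F} {T : E →L[ℝ] E}

theorem l_pos : 0 < F.l := F.q_pos.trans F.q_lt_l

theorem rate_nonneg : 0 ≤ F.q / F.l := div_nonneg F.q_pos.le F.l_pos.le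

theorem rate_lt_one : F.q / F.l < 1 := (div_lt_one F.l_pos).2 F.q_lt_l

theorem p_e_pos : 0 < F.p F.e := by
  refine lt_of_lt_of_le (norm_pos_iff.2 fun he => ?_) (F.norm_le F.e)
  simpa [he] using F.φ_e

theorem continuous_p : Continuous F.p := by
  refine (LipschitzWith.of_dist_le' (K := F.C) fun x y => ?_).continuous
  rw [Real.dist_eq, dist_eq_norm]
  exact (abs_sub_map_le_sub F.p x y).trans (F.le_norm _)

theorem v₀_mem_base : F.v₀ ∈ F.base := ⟨F.φ_v₀, by simpa using F.δ_nonneg⟩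

theorem isClosed_base : IsClosed F.base :=
  (isClosed_eq F.φ.continuous continuous_const).inter
    (isClosed_le (continuous_p.comp (continuous_id.sub continuous_const)) continuous_const)

theorem φ_sub_eq_zero {x y : E} (hx : x ∈ F.base) (hy : y ∈ F.base) : F.φ (x - y) = 0 := by
  rw [map_sub, hx.1, hy.1, sub_self]

theorem φ_sub_smul_eq_zero {y : E} (hy : y ∈ F.base) (x : E) : F.φ (x - F.φ x • y) = 0 := by
  rw [map_sub, map_smul, hy.1, smul_eq_mul, mul_one, sub_self]

theorem p_sub_e_le {x : E} (hx : x ∈ F.base) : F.p (x - F.e) ≤ F.p F.e := by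
  rw [← sub_add_sub_cancel x F.v₀ F.e]
  linarith [map_add_le_add F.p (x - F.v₀) (F.v₀ - F.e), hx.2, F.center]

theorem abs_φ_mul_le (x : E) : |F.φ x| * F.p F.e ≤ F.p x := by
  rw [F.split x]
  exact le_add_of_nonneg_left (apply_nonneg _ _)

theorem p_sub_smul_le {y : E} (hy : y ∈ F.base) (x : E) : F.p (x - F.φ x • y) ≤ F.p x :=
  calc F.p (x - F.φ x • y) = F.p ((x - F.φ x • F.e) - F.φ x • (y - F.e)) := by
        congr 1; module
    _ ≤ F.p (x - F.φ x • F.e) + |F.φ x| * F.p (y - F.e) :=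
        (map_sub_le_add F.p _ _).trans_eq (by rw [map_smul_eq_mul, Real.norm_eq_abs])
    _ ≤ F.p (x - F.φ x • F.e) + |F.φ x| * F.p F.e := by gcongr; exact p_sub_e_le hy
    _ = F.p x := (F.split x).symm

theorem tendsto_of_tendsto_p {ι : Type*} {f : Filter ι} {x : ι → E} {y : E}
    (h : Tendsto (fun i => F.p (x i - y)) f (𝓝 0)) : Tendsto x f (𝓝 y) :=
  tendsto_iff_norm_sub_tendsto_zero.2
    (squeeze_zero (fun _ => norm_nonneg _) (fun _ => F.norm_le _) h)

namespace Contracts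

theorem abs_φ_le (hT : F.Contracts T) {k : E} (hk : F.φ k = 0) :
    |F.φ (T k)| ≤ F.q / F.p F.e * F.p k := by
  rw [div_mul_eq_mul_div, le_div_iff₀ p_e_pos]
  exact (abs_φ_mul_le _).trans (hT.contr k hk)

theorem p_sub_smul_le (hT : F.Contracts T) {k y : E} (hk : F.φ k = 0) (hy : y ∈ F.base) :
    F.p (T k - F.φ (T k) • y) ≤ F.q * F.p k :=
  (ConeFrame.p_sub_smul_le hy _).trans (hT.contr k hk)

theorem le_φ (hT : F.Contracts T) {x : E} (hx : x ∈ F.base) : F.l ≤ F.φ (T x) := by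
  have hdev := hT.abs_φ_le (φ_sub_eq_zero hx v₀_mem_base)
  have hδ : F.q / F.p F.e * F.p (x - F.v₀) ≤ F.q / F.p F.e * F.δ :=
    mul_le_mul_of_nonneg_left hx.2 (div_nonneg F.q_pos.le p_e_pos.le)
  rw [map_sub, map_sub] at hdev
  linarith [(abs_le.1 hdev).1, hT.lower]

theorem φ_pos (hT : F.Contracts T) {x : E} (hx : x ∈ F.base) : 0 < F.φ (T x) :=
  l_pos.trans_le (hT.le_φ hx)

theorem φ_smul_normalized (hT : F.Contracts T) {x : E} (hx : x ∈ F.base) :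
    F.φ (T x) • F.normalized T x = T x := smul_inv_smul₀ (hT.φ_pos hx).ne' _

theorem p_normalized_sub_eq (hT : F.Contracts T) {x : E} (hx : x ∈ F.base) (y : E) :
    F.φ (T x) * F.p (F.normalized T x - y) = F.p (T x - F.φ (T x) • y) := by
  rw [← abs_of_pos (hT.φ_pos hx), ← Real.norm_eq_abs, ← map_smul_eq_mul, smul_sub,
    Real.norm_eq_abs, abs_of_pos (hT.φ_pos hx), hT.φ_smul_normalized hx]

theorem normalized_mem_base (hT : F.Contracts T) {x : E} (hx : x ∈ F.base) :
    F.normalized T x ∈ F.base := by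
  have hpos := hT.φ_pos hx
  refine ⟨by simp [normalized, inv_mul_cancel₀ hpos.ne'], le_of_mul_le_mul_left ?_ hpos⟩
  set k := x - F.v₀
  have hdecomp : T x - F.φ (T x) • F.v₀
      = (T k - F.φ (T k) • F.v₀) + (T F.v₀ - F.φ (T F.v₀) • F.v₀) := by
    simp only [k, map_sub]
    module
  calc F.φ (T x) * F.p (F.normalized T x - F.v₀)
      = F.p (T x - F.φ (T x) • F.v₀) := hT.p_normalized_sub_eq hx _
    _ ≤ F.q * F.p k + (F.l - F.q) * F.δ := by
        rw [hdecomp]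
        exact (map_add_le_add F.p _ _).trans (add_le_add
          (hT.p_sub_smul_le (φ_sub_eq_zero hx v₀_mem_base) v₀_mem_base) hT.residual)
    _ ≤ F.l * F.δ := by linarith [mul_le_mul_of_nonneg_left hx.2 F.q_pos.le]
    _ ≤ F.φ (T x) * F.δ := mul_le_mul_of_nonneg_right (hT.le_φ hx) F.δ_nonneg

theorem p_normalized_sub_le (hT : F.Contracts T) {x y : E} (hx : x ∈ F.base) (hy : y ∈ F.base) :
    F.p (F.normalized T x - F.normalized T y) ≤ F.q / F.l * F.p (x - y) := by
  have hdecomp : T x - F.φ (T x) • F.normalized T y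
      = T (x - y) - F.φ (T (x - y)) • F.normalized T y := by
    conv_rhs => rw [map_sub, map_sub, sub_smul, hT.φ_smul_normalized hy]
    abel
  rw [div_mul_eq_mul_div, le_div_iff₀ l_pos, mul_comm _ F.l]
  calc F.l * F.p (F.normalized T x - F.normalized T y)
      ≤ F.φ (T x) * F.p (F.normalized T x - F.normalized T y) :=
        mul_le_mul_of_nonneg_right (hT.le_φ hx) (apply_nonneg _ _)
    _ = F.p (T (x - y) - F.φ (T (x - y)) • F.normalized T y) := by
        rw [hT.p_normalized_sub_eq hx, hdecomp]
    _ ≤ F.q * F.p (x - y) := hT.p_sub_smul_le (φ_sub_eq_zero hx hy) (hT.normalized_mem_base hy)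

theorem exists_right_eigenvector [CompleteSpace E] (hT : F.Contracts T) :
    ∃ v ∈ F.base, T v = F.φ (T v) • v := by
  set x : ℕ → E := fun n => (F.normalized T)^[n] F.v₀
  have hsucc : ∀ n, x (n + 1) = F.normalized T (x n) := fun n =>
    Function.iterate_succ_apply' _ _ _
  have hmem : ∀ n, x n ∈ F.base := fun n => by
    induction n with
    | zero => exact v₀_mem_base
    | succ n ih => exact hsucc n ▸ hT.normalized_mem_base ih
  have hstep : ∀ n, F.p (x n - x (n + 1)) ≤ F.p (x 0 - x 1) * (F.q / F.l) ^ n := fun n => by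
    induction n with
    | zero => simp
    | succ n ih =>
      rw [hsucc n, hsucc (n + 1), pow_succ, ← mul_assoc, mul_comm _ (F.q / F.l)]
      exact (hT.p_normalized_sub_le (hmem n) (hmem (n + 1))).trans
        (mul_le_mul_of_nonneg_left ih rate_nonneg)
  have hcauchy : CauchySeq x :=
    cauchySeq_of_le_geometric _ _ rate_lt_one fun n =>
      (dist_eq_norm (x n) _).trans_le ((F.norm_le _).trans (hstep n))
  obtain ⟨v, hv⟩ := cauchySeq_tendsto_of_complete hcauchy
  have hlim := (T.continuous.tendsto v).comp hv
  refine ⟨v, isClosed_base.mem_of_tendsto hv (Eventually.of_forall hmem),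
    tendsto_nhds_unique hlim ?_⟩
  refine (((F.φ.continuous.tendsto _).comp hlim).smul
    (hv.comp (tendsto_add_atTop_nat 1))).congr fun n => ?_
  simp only [Function.comp_apply, hsucc, hT.φ_smul_normalized (hmem n)]

section PowerIteration

variable {v : E} {μ : ℝ}

theorem p_pow_sub_le (hT : F.Contracts T) (hv : v ∈ F.base) (hTv : T v = μ • v) (x : E) (n : ℕ) :
    F.p ((T ^ n) x - F.φ ((T ^ n) x) • v) ≤ F.q ^ n * F.p x := by
  induction n with
  | zero => simpa using ConeFrame.p_sub_smul_le hv x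
  | succ n ih =>
    set y := (T ^ n) x
    set k := y - F.φ y • v
    have hdecomp : T y - F.φ (T y) • v = T k - F.φ (T k) • v := by
      simp only [k, map_sub, map_smul, hTv, hv.1, smul_eq_mul, mul_one]
      module
    rw [pow_succ' T, mul_apply_eq_comp, hdecomp, pow_succ', mul_assoc]
    exact (hT.p_sub_smul_le (φ_sub_smul_eq_zero hv _) hv).trans
      (mul_le_mul_of_nonneg_left ih F.q_pos.le)

theorem dist_left_iterate_le (hT : F.Contracts T) (hv : v ∈ F.base) (hTv : T v = μ • v)
    (hμ : F.l ≤ μ) (n : ℕ) :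
    dist ((μ ^ n)⁻¹ • F.φ.comp (T ^ n)) ((μ ^ (n + 1))⁻¹ • F.φ.comp (T ^ (n + 1)))
      ≤ F.q / F.l * (F.C / F.p F.e) * (F.q / F.l) ^ n := by
  have hμ₀ : 0 < μ := l_pos.trans_le hμ
  have hq := F.q_pos
  have hl : 0 < F.l := l_pos
  have he : 0 < F.p F.e := p_e_pos
  have hC : 0 ≤ F.C := nonneg_of_mul_nonneg_left (he.le.trans (F.le_norm _))
    (norm_pos_iff.2 fun h => by simpa [h] using F.φ_e)
  rw [dist_comm, dist_eq_norm]
  refine ContinuousLinearMap.opNorm_le_bound _ (by positivity) fun x => ?_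
  set r := (T ^ n) x - F.φ ((T ^ n) x) • v
  have hdiff : ((μ ^ (n + 1))⁻¹ • F.φ.comp (T ^ (n + 1)) - (μ ^ n)⁻¹ • F.φ.comp (T ^ n)) x
      = (μ ^ (n + 1))⁻¹ * F.φ (T r) := by
    simp only [r, pow_succ' T, sub_apply, smul_apply,
      ContinuousLinearMap.comp_apply, mul_apply_eq_comp, map_sub, map_smul, hTv, hv.1,
      smul_eq_mul, mul_one]
    field_simp
    ring
  have hr : F.p r ≤ F.q ^ n * (F.C * ‖x‖) :=
    (hT.p_pow_sub_le hv hTv x n).trans (by gcongr; exact F.le_norm x)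
  rw [hdiff, norm_mul, Real.norm_of_nonneg (by positivity), Real.norm_eq_abs]
  calc (μ ^ (n + 1))⁻¹ * |F.φ (T r)|
      ≤ (F.l ^ (n + 1))⁻¹ * (F.q / F.p F.e * (F.q ^ n * (F.C * ‖x‖))) := by
        gcongr
        exact (hT.abs_φ_le (φ_sub_smul_eq_zero hv _)).trans (by gcongr)
    _ = F.q / F.l * (F.C / F.p F.e) * (F.q / F.l) ^ n * ‖x‖ := by
        rw [div_pow, pow_succ]
        field_simp

end PowerIteration

theorem exists_isPrincipal [CompleteSpace E] (hT : F.Contracts T) :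
    ∃ μ v w, F.IsPrincipal T μ v w := by
  obtain ⟨v, hv, hTv⟩ := hT.exists_right_eigenvector
  obtain ⟨w, hw⟩ := cauchySeq_tendsto_of_complete (cauchySeq_of_le_geometric _ _ rate_lt_one
    (hT.dist_left_iterate_le hv hTv (hT.le_φ hv)))
  exact ⟨F.φ (T v), v, w, hv, hT.le_φ hv, hTv, hw⟩

theorem compression (hT : F.Contracts T) {Q : E →L[ℝ] E} (hpQ : ∀ x, F.p (Q x) ≤ F.p x)
    (hφQ : ∀ x, F.φ (Q x) = F.φ x) (hQv₀ : Q F.v₀ = F.v₀) :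
    F.Contracts (Q.comp (T.comp Q)) where
  contr k hk := (hpQ _).trans ((hT.contr (Q k) (by rwa [hφQ])).trans
    (mul_le_mul_of_nonneg_left (hpQ k) F.q_pos.le))
  residual := by
    have hQ : Q (T F.v₀) - F.φ (T F.v₀) • F.v₀ = Q (T F.v₀ - F.φ (T F.v₀) • F.v₀) := by
      rw [map_sub, map_smul, hQv₀]
    simp only [ContinuousLinearMap.comp_apply, hφQ, hQv₀, hQ]
    exact (hpQ _).trans hT.residual
  lower := by simpa only [ContinuousLinearMap.comp_apply, hφQ, hQv₀] using hT.lower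

end Contracts

namespace IsPrincipal

variable {μ : ℝ} {v : E} {w : E →L[ℝ] ℝ}

theorem eigenvalue_pos (h : F.IsPrincipal T μ v w) : 0 < μ := l_pos.trans_le h.le_eigenvalue

theorem eigenvalue_eq (h : F.IsPrincipal T μ v w) : μ = F.φ (T v) := by
  rw [h.right_eigen, map_smul, h.mem_base.1, smul_eq_mul, mul_one]

theorem normalized_eq (h : F.IsPrincipal T μ v w) : F.normalized T v = v := by
  rw [normalized, ← h.eigenvalue_eq, h.right_eigen, inv_smul_smul₀ h.eigenvalue_pos.ne']

theorem tendsto_left_apply (h : F.IsPrincipal T μ v w) (x : E) :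
    Tendsto (fun n : ℕ => (μ ^ n)⁻¹ * F.φ ((T ^ n) x)) atTop (𝓝 (w x)) :=
  ((ContinuousLinearMap.apply ℝ ℝ x).continuous.tendsto w).comp h.tendsto_left

theorem left_eigen (h : F.IsPrincipal T μ v w) (x : E) : w (T x) = μ * w x := by
  refine tendsto_nhds_unique (h.tendsto_left_apply (T x)) ?_
  refine (((h.tendsto_left_apply x).comp (tendsto_add_atTop_nat 1)).const_mul μ).congr fun n => ?_
  have hμ := h.eigenvalue_pos.ne'
  rw [Function.comp_apply, pow_succ T, mul_apply_eq_comp, pow_succ]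
  field_simp

theorem pairing (h : F.IsPrincipal T μ v w) : w v = 1 := by
  refine tendsto_nhds_unique (h.tendsto_left_apply v) (tendsto_const_nhds.congr fun n => ?_)
  rw [pow_apply_of_apply_eq_smul h.right_eigen, map_smul, h.mem_base.1, smul_eq_mul, mul_one,
    inv_mul_cancel₀ (pow_ne_zero n h.eigenvalue_pos.ne')]

theorem hasSpectralGap (h : F.IsPrincipal T μ v w) (hT : F.Contracts T) :
    HasSpectralGap T F.q μ v w where
  rate_nonneg := F.q_pos.le
  rate_lt := F.q_lt_l.trans_le h.le_eigenvalue
  right_eigen := h.right_eigen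
  left_eigen := h.left_eigen
  pairing := h.pairing
  bound := by
    refine ⟨(1 + ‖w‖ * ‖v‖) * F.C, fun n x => ?_⟩
    set r := (T ^ n) x - F.φ ((T ^ n) x) • v
    have hdecomp : (T ^ n) x - (μ ^ n * w x) • v = r - w r • v := by
      simp only [r, map_sub, map_smul, h.pairing, functional_pow_apply h.left_eigen, smul_eq_mul,
        mul_one]
      module
    have hr : ‖r‖ ≤ F.q ^ n * (F.C * ‖x‖) := (F.norm_le r).trans
      ((hT.p_pow_sub_le h.mem_base h.right_eigen x n).trans
        (mul_le_mul_of_nonneg_left (F.le_norm x) (pow_nonneg F.q_pos.le n)))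
    calc ‖(T ^ n) x - (μ ^ n * w x) • v‖ ≤ ‖r‖ + ‖w‖ * ‖r‖ * ‖v‖ := by
          rw [hdecomp]
          refine (norm_sub_le _ _).trans ?_
          rw [norm_smul]
          gcongr
          exact w.le_opNorm r
      _ = (1 + ‖w‖ * ‖v‖) * ‖r‖ := by ring
      _ ≤ (1 + ‖w‖ * ‖v‖) * (F.q ^ n * (F.C * ‖x‖)) := by gcongr
      _ = (1 + ‖w‖ * ‖v‖) * F.C * F.q ^ n * ‖x‖ := by ring

/-- Split `T k = φ (T k) • e + k'` with `k'` in `ker φ` and apply the bound `B` to both terms. -/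
theorem abs_left_mul_le_improve (h : F.IsPrincipal T μ v w) (hT : F.Contracts T) {B : ℝ}
    (heB : |w F.e| ≤ B) (hB : ∀ k, F.φ k = 0 → |w k| * F.p F.e ≤ B * F.p k) {k : E}
    (hk : F.φ k = 0) : |w k| * F.p F.e ≤ F.q / μ * B * F.p k := by
  have hμ := h.eigenvalue_pos
  have hB₀ : 0 ≤ B := (abs_nonneg _).trans heB
  set k' := T k - F.φ (T k) • F.e with hk'
  have hφk' : F.φ k' = 0 := by simp [hk', F.φ_e]
  have hTk : w (T k) = w k' + F.φ (T k) * w F.e := by simp [hk']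
  have hbound : μ * (|w k| * F.p F.e) ≤ B * (F.q * F.p k) :=
    calc μ * (|w k| * F.p F.e) = |w (T k)| * F.p F.e := by
          rw [h.left_eigen, abs_mul, abs_of_pos hμ, mul_assoc]
      _ ≤ (|w k'| + |F.φ (T k)| * |w F.e|) * F.p F.e := by
          rw [hTk, ← abs_mul]
          gcongr
          exact abs_add_le _ _
      _ = |w k'| * F.p F.e + |w F.e| * (|F.φ (T k)| * F.p F.e) := by ring
      _ ≤ B * F.p k' + B * (|F.φ (T k)| * F.p F.e) := add_le_add (hB k' hφk') (by gcongr)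
      _ = B * F.p (T k) := by rw [F.split (T k), mul_add]
      _ ≤ B * (F.q * F.p k) := mul_le_mul_of_nonneg_left (hT.contr k hk) hB₀
  rw [div_mul_eq_mul_div, div_mul_eq_mul_div, le_div_iff₀ hμ]
  linarith

theorem abs_left_mul_le_pow (h : F.IsPrincipal T μ v w) (hT : F.Contracts T) {k : E}
    (hk : F.φ k = 0) (n : ℕ) :
    |w k| * F.p F.e ≤ (|w F.e| + (F.q / μ) ^ n * (‖w‖ * F.p F.e)) * F.p k := by
  have hq := F.q_pos
  have hμ := h.eigenvalue_pos
  have he : 0 < F.p F.e := p_e_pos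
  induction n generalizing k with
  | zero =>
    have hw : |w k| ≤ ‖w‖ * F.p k :=
      (w.le_opNorm k).trans (by gcongr; exact F.norm_le k)
    nlinarith [mul_nonneg (abs_nonneg (w F.e)) (apply_nonneg F.p k)]
  | succ n ih =>
    have hrate : F.q / μ ≤ 1 := (div_le_one hμ).2 (F.q_lt_l.le.trans h.le_eigenvalue)
    refine (h.abs_left_mul_le_improve hT (le_add_of_nonneg_right (by positivity))
      (fun _ hk => ih hk) hk).trans (mul_le_mul_of_nonneg_right ?_ (apply_nonneg _ _))
    rw [mul_add, pow_succ', mul_assoc (F.q / μ)]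
    gcongr
    exact mul_le_of_le_one_left (abs_nonneg _) hrate

theorem abs_left_mul_le (h : F.IsPrincipal T μ v w) (hT : F.Contracts T) {k : E}
    (hk : F.φ k = 0) : |w k| * F.p F.e ≤ |w F.e| * F.p k := by
  have hrate : Tendsto (fun n : ℕ => (F.q / μ) ^ n) atTop (𝓝 0) :=
    tendsto_pow_atTop_nhds_zero_of_lt_one (div_nonneg F.q_pos.le h.eigenvalue_pos.le)
      ((div_lt_one h.eigenvalue_pos).2 (F.q_lt_l.trans_le h.le_eigenvalue))
  have hlim := ((hrate.mul_const (‖w‖ * F.p F.e)).const_add |w F.e|).mul_const (F.p k)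
  rw [zero_mul, add_zero] at hlim
  exact ge_of_tendsto' hlim (h.abs_left_mul_le_pow hT hk)

theorem left_e_pos (h : F.IsPrincipal T μ v w) (hT : F.Contracts T) : 0 < w F.e := by
  have hk : F.φ (v - F.e) = 0 := by rw [map_sub, h.mem_base.1, F.φ_e, sub_self]
  have hbound : |w (v - F.e)| ≤ |w F.e| := by
    refine le_of_mul_le_mul_right ((h.abs_left_mul_le hT hk).trans ?_) p_e_pos
    exact mul_le_mul_of_nonneg_left (p_sub_e_le h.mem_base) (abs_nonneg _)
  rw [map_sub, h.pairing] at hbound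
  by_contra! hneg
  rw [abs_of_nonpos hneg] at hbound
  linarith [le_abs_self (1 - w F.e)]

end IsPrincipal

section Limits

variable {ι : Type*} {f : Filter ι} {Tι : ι → E →L[ℝ] E} {μι : ι → ℝ} {vι : ι → E}
  {wι : ι → E →L[ℝ] ℝ} {μ : ℝ} {v : E} {w : E →L[ℝ] ℝ}

theorem tendsto_right_eigenvector (hT : ∀ᶠ i in f, F.Contracts (Tι i))
    (hι : ∀ᶠ i in f, F.IsPrincipal (Tι i) (μι i) (vι i) (wι i)) (h : F.IsPrincipal T μ v w)
    (hlim : Tendsto (fun i => Tι i v) f (𝓝 (T v))) : Tendsto vι f (𝓝 v) := by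
  have hpos : 0 < F.φ (T v) := h.eigenvalue_eq ▸ h.eigenvalue_pos
  have hnorm : Tendsto (fun i => F.normalized (Tι i) v) f (𝓝 v) := by
    have := ((F.φ.continuous.tendsto _).comp hlim).inv₀ hpos.ne' |>.smul hlim
    rwa [← normalized, h.normalized_eq] at this
  have hdefect : Tendsto (fun i => F.p (F.normalized (Tι i) v - v) / (1 - F.q / F.l)) f (𝓝 0) := by
    have := ((continuous_p (F := F)).tendsto (v - v)).comp (hnorm.sub_const v)
    simpa using this.div_const (1 - F.q / F.l)
  refine tendsto_of_tendsto_p (F := F)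
    (squeeze_zero' (Eventually.of_forall fun _ => apply_nonneg _ _) ?_ hdefect)
  filter_upwards [hT, hι] with i hTi hi
  have hstep := hTi.p_normalized_sub_le hi.mem_base h.mem_base
  rw [hi.normalized_eq] at hstep
  rw [le_div_iff₀ (sub_pos.2 rate_lt_one), mul_sub, mul_one]
  have htri := map_add_le_add F.p (vι i - F.normalized (Tι i) v) (F.normalized (Tι i) v - v)
  rw [sub_add_sub_cancel] at htri
  linarith

theorem tendsto_eigenvalue (hι : ∀ᶠ i in f, F.IsPrincipal (Tι i) (μι i) (vι i) (wι i))
    (h : F.IsPrincipal T μ v w) (hφ : Tendsto (fun i => F.φ.comp (Tι i)) f (𝓝 (F.φ.comp T)))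
    (hv : Tendsto vι f (𝓝 v)) : Tendsto μι f (𝓝 μ) := by
  rw [h.eigenvalue_eq]
  have happly := (isBoundedBilinearMap_apply (𝕜 := ℝ) (E := E) (F := ℝ)).continuous.tendsto
    (F.φ.comp T, v)
  exact (happly.comp (hφ.prodMk_nhds hv)).congr' (hι.mono fun i hi => hi.eigenvalue_eq.symm)

/-- The convergence of the functionals `μ⁻ⁿ • φ ∘ Tⁿ` to the left eigenvector is uniform in `T`, so
the limits in `n` and in `T` may be interchanged. -/
theorem tendsto_left_eigenvector (hT : ∀ᶠ i in f, F.Contracts (Tι i))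
    (hι : ∀ᶠ i in f, F.IsPrincipal (Tι i) (μι i) (vι i) (wι i)) (h : F.IsPrincipal T μ v w)
    (hφ : ∀ n : ℕ, Tendsto (fun i => F.φ.comp (Tι i ^ n)) f (𝓝 (F.φ.comp (T ^ n))))
    (hμ : Tendsto μι f (𝓝 μ)) : Tendsto wι f (𝓝 w) := by
  set K := F.q / F.l * (F.C / F.p F.e)
  have hunif : TendstoUniformlyOnFilter (fun (n : ℕ) i => (μι i ^ n)⁻¹ • F.φ.comp (Tι i ^ n)) wι
      atTop f := by
    rw [Metric.tendstoUniformlyOnFilter_iff]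
    intro ε hε
    have hrate : Tendsto (fun n : ℕ => K * (F.q / F.l) ^ n / (1 - F.q / F.l)) atTop (𝓝 0) := by
      simpa using ((tendsto_pow_atTop_nhds_zero_of_lt_one rate_nonneg rate_lt_one).const_mul
        K).div_const (1 - F.q / F.l)
    refine ((hrate.eventually (gt_mem_nhds hε)).prod_mk (hT.and hι)).mono ?_
    rintro ⟨n, i⟩ ⟨hn, hTi, hi⟩
    rw [dist_comm]
    exact (dist_le_of_le_geometric_of_tendsto _ _ rate_lt_one
      (hTi.dist_left_iterate_le hi.mem_base hi.right_eigen hi.le_eigenvalue)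
      hi.tendsto_left n).trans_lt hn
  refine hunif.tendsto_of_eventually_tendsto (Eventually.of_forall fun n => ?_) h.tendsto_left
  exact ((hμ.pow n).inv₀ (pow_ne_zero n h.eigenvalue_pos.ne')).smul (hφ n)

end Limits

end ConeFrame

theorem tendsto_functional_comp_compression_pow {E ι : Type*} [NormedAddCommGroup E]
    [NormedSpace ℝ E] {f : Filter ι} {φ : E →L[ℝ] ℝ} {T : E →L[ℝ] E} {Q : ι → E →L[ℝ] E}
    (hQ : ∀ i, ‖Q i‖ ≤ 1)
    (hφ : ∀ n : ℕ, Tendsto (fun i => (φ.comp (T ^ n)).comp (Q i)) f (𝓝 (φ.comp (T ^ n)))) (n : ℕ) :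
    Tendsto (fun i => φ.comp (((Q i).comp (T.comp (Q i))) ^ n)) f (𝓝 (φ.comp (T ^ n))) := by
  induction n with
  | zero => exact tendsto_const_nhds
  | succ n ih =>
    set ψ := φ.comp (T ^ n)
    set ψι := fun i => φ.comp (((Q i).comp (T.comp (Q i))) ^ n)
    have hψT : φ.comp (T ^ (n + 1)) = ψ.comp T := by ext; simp [ψ, pow_succ]
    have hφn := hφ (n + 1)
    rw [hψT] at hφn ⊢
    have hbound := (((tendsto_iff_norm_sub_tendsto_zero.1 ih).mul_const ‖T‖).add
      ((tendsto_iff_norm_sub_tendsto_zero.1 (hφ n)).mul_const ‖T‖)).add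
      (tendsto_iff_norm_sub_tendsto_zero.1 hφn)
    simp only [zero_mul, add_zero] at hbound
    refine tendsto_iff_norm_sub_tendsto_zero.2
      (squeeze_zero (fun _ => norm_nonneg _) (fun i => ?_) hbound)
    have hdecomp : φ.comp (((Q i).comp (T.comp (Q i))) ^ (n + 1)) - ψ.comp T
        = (ψι i - ψ).comp ((Q i).comp (T.comp (Q i)))
          + (ψ.comp (Q i) - ψ).comp (T.comp (Q i)) + ((ψ.comp T).comp (Q i) - ψ.comp T) := by
      ext x
      simp [ψ, ψι, pow_succ]
    have hTQ : ‖T.comp (Q i)‖ ≤ ‖T‖ :=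
      (T.opNorm_comp_le (Q i)).trans (mul_le_of_le_one_right (norm_nonneg _) (hQ i))
    have hQTQ : ‖(Q i).comp (T.comp (Q i))‖ ≤ ‖T‖ :=
      ((Q i).opNorm_comp_le _).trans ((mul_le_of_le_one_left (norm_nonneg _) (hQ i)).trans hTQ)
    rw [hdecomp]
    refine (norm_add₃_le).trans ?_
    gcongr
    exacts [(ContinuousLinearMap.opNorm_comp_le _ _).trans (by gcongr),
      (ContinuousLinearMap.opNorm_comp_le _ _).trans (by gcongr)]

section EllOne

/-- The standard unit vectors of `ℓ¹`. -/
noncomputable def unitVec (i : ℕ) : EllOne := lp.single 1 i 1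

theorem unitVec_apply (i j : ℕ) : unitVec i j = if j = i then 1 else 0 := by
  rw [unitVec, lp.single_apply, Pi.single_apply]

theorem single_eq_smul_unitVec (i : ℕ) (a : ℝ) : lp.single 1 i a = a • unitVec i := by
  rw [unitVec, ← lp.single_smul, smul_eq_mul, mul_one]

theorem norm_unitVec (i : ℕ) : ‖unitVec i‖ = 1 := by
  rw [unitVec, lp.norm_single (by simp), norm_one]

theorem hasSum_unitVec (x : EllOne) : HasSum (fun i => x i • unitVec i) x := by
  simpa only [single_eq_smul_unitVec] using lp.hasSum_single (p := 1) (by simp) x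

theorem hasSum_functional (w : EllOne →L[ℝ] ℝ) (x : EllOne) :
    HasSum (fun i => w (unitVec i) * x i) (w x) := by
  simpa only [map_smul, smul_eq_mul, mul_comm] using (hasSum_unitVec x).mapL w

theorem abs_apply_unitVec_le (w : EllOne →L[ℝ] ℝ) (i : ℕ) : |w (unitVec i)| ≤ ‖w‖ := by
  simpa [norm_unitVec] using w.le_opNorm (unitVec i)

/-- The row vector of a functional on `ℓ¹`. -/
noncomputable def dualSeq : (EllOne →L[ℝ] ℝ) →L[ℝ] EllInf :=
  LinearMap.mkContinuous
    { toFun := fun w => ⟨fun i => w (unitVec i), memℓp_infty ⟨‖w‖, by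
        rintro _ ⟨i, rfl⟩
        exact abs_apply_unitVec_le w i⟩⟩
      map_add' := fun _ _ => rfl
      map_smul' := fun _ _ => rfl } 1 fun w => by
    rw [one_mul]
    exact lp.norm_le_of_forall_le (norm_nonneg w) (abs_apply_unitVec_le w)

theorem dualSeq_apply (w : EllOne →L[ℝ] ℝ) (i : ℕ) : dualSeq w i = w (unitVec i) := rfl

theorem rowMul_dualSeq (w : EllOne →L[ℝ] ℝ) (x : EllOne) : rowMul (dualSeq w) x = w x :=
  (hasSum_functional w x).tsum_eq

/-- Truncation of a sequence to the indices `0, …, m`. -/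
noncomputable def trunc (m : ℕ) : EllOne →L[ℝ] EllOne :=
  ∑ i ∈ Finset.range (m + 1), (lp.evalCLM ℝ (fun _ : ℕ => ℝ) 1 i).smulRight (unitVec i)

theorem trunc_eq_sum (m : ℕ) (x : EllOne) :
    trunc m x = ∑ i ∈ Finset.range (m + 1), x i • unitVec i := by
  simp only [trunc, sum_apply]
  rfl

theorem trunc_apply (m : ℕ) (x : EllOne) (i : ℕ) : trunc m x i = if i ≤ m then x i else 0 := by
  simp only [trunc_eq_sum, lp.coeFn_sum, Finset.sum_apply, lp.coeFn_smul, Pi.smul_apply,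
    unitVec_apply, smul_eq_mul, mul_ite, mul_one, mul_zero, Finset.sum_ite_eq, Finset.mem_range,
    Nat.lt_succ_iff]

theorem trunc_unitVec {m i : ℕ} (hi : i ≤ m) : trunc m (unitVec i) = unitVec i := by
  ext j
  rw [trunc_apply, unitVec_apply]
  split_ifs <;> first | rfl | omega

theorem abs_trunc_le (m : ℕ) (x : EllOne) (i : ℕ) : |trunc m x i| ≤ |x i| := by
  rw [trunc_apply]
  split_ifs
  · rfl
  · simp

theorem norm_trunc_apply_le (m : ℕ) (x : EllOne) : ‖trunc m x‖ ≤ ‖x‖ := by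
  rw [ellOne_norm, ellOne_norm]
  exact (ellOne_summable _).tsum_le_tsum (abs_trunc_le m x) (ellOne_summable x)

theorem norm_trunc_le (m : ℕ) : ‖trunc m‖ ≤ 1 :=
  ContinuousLinearMap.opNorm_le_bound _ zero_le_one fun x => by
    simpa using norm_trunc_apply_le m x

theorem tendsto_trunc (x : EllOne) : Tendsto (fun m => trunc m x) atTop (𝓝 x) := by
  simp only [trunc_eq_sum]
  exact (hasSum_unitVec x).tendsto_sum_nat.comp (tendsto_add_atTop_nat 1)

theorem tendsto_trunc_comp_trunc (T : EllOne →L[ℝ] EllOne) (x : EllOne) :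
    Tendsto (fun m => trunc m (T (trunc m x))) atTop (𝓝 (T x)) := by
  have hx := (T.continuous.tendsto x).comp (tendsto_trunc x)
  have herr : Tendsto (fun m => trunc m (T (trunc m x) - T x)) atTop (𝓝 0) :=
    squeeze_zero_norm (fun m => norm_trunc_apply_le m _) (tendsto_iff_norm_sub_tendsto_zero.1 hx)
  simpa only [map_sub, sub_add_cancel, zero_add] using herr.add (tendsto_trunc (T x))

theorem norm_comp_trunc_sub_le (w : EllOne →L[ℝ] ℝ) {m : ℕ} {ε : ℝ} (hε : 0 ≤ ε)
    (hw : ∀ j, m < j → |w (unitVec j)| ≤ ε) : ‖w.comp (trunc m) - w‖ ≤ ε := by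
  refine ContinuousLinearMap.opNorm_le_bound _ hε fun x => ?_
  rw [sub_apply, ContinuousLinearMap.comp_apply, ← map_sub,
    ← (hasSum_functional w _).tsum_eq, ellOne_norm, ← tsum_mul_left]
  refine tsum_of_norm_bounded ((ellOne_summable x).mul_left ε).hasSum fun j => ?_
  rw [lp.coeFn_sub, Pi.sub_apply, trunc_apply, norm_mul]
  split_ifs with hj
  · rw [sub_self, norm_zero, mul_zero]
    positivity
  · rw [zero_sub, norm_neg]
    exact mul_le_mul_of_nonneg_right (hw j (not_le.1 hj)) (norm_nonneg _)

theorem tendsto_comp_trunc {w : EllOne →L[ℝ] ℝ}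
    (hw : Tendsto (fun j => w (unitVec j)) atTop (𝓝 0)) :
    Tendsto (fun m => w.comp (trunc m)) atTop (𝓝 w) := by
  rw [Metric.tendsto_atTop] at hw ⊢
  intro ε hε
  obtain ⟨N, hN⟩ := hw (ε / 2) (half_pos hε)
  refine ⟨N, fun m hm => ?_⟩
  rw [dist_eq_norm]
  refine (norm_comp_trunc_sub_le w (half_pos hε).le fun j hj => ?_).trans_lt (half_lt_self hε)
  simpa using (hN j (hm.trans hj.le)).le

/-- A functional that vanishes at infinity is weak-* continuous on bounded sets: its truncations
converge to it uniformly there, and each of them depends on finitely many coordinates. -/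
theorem tendsto_functional_of_tendsto_apply {ι : Type*} {f : Filter ι} {w : EllOne →L[ℝ] ℝ}
    (hw : Tendsto (fun j => w (unitVec j)) atTop (𝓝 0)) {x : ι → EllOne} {B : ℝ}
    (hB : ∀ i, ‖x i‖ ≤ B) (hx : ∀ k, Tendsto (fun i => x i k) f (𝓝 0)) :
    Tendsto (fun i => w (x i)) f (𝓝 0) := by
  have hunif : TendstoUniformlyOnFilter (fun m i => w (trunc m (x i))) (fun i => w (x i))
      atTop f := by
    rw [Metric.tendstoUniformlyOnFilter_iff]
    intro ε hε
    have herr := (tendsto_iff_norm_sub_tendsto_zero.1 (tendsto_comp_trunc hw)).mul_const B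
    rw [zero_mul] at herr
    refine ((herr.eventually (gt_mem_nhds hε)).prod_inl f).mono ?_
    rintro ⟨m, i⟩ hm
    rw [dist_comm, dist_eq_norm]
    refine lt_of_le_of_lt ?_ hm
    exact ((w.comp (trunc m) - w).le_opNorm (x i)).trans
      (mul_le_mul_of_nonneg_left (hB i) (norm_nonneg _))
  refine hunif.tendsto_of_eventually_tendsto (Eventually.of_forall fun m => ?_) tendsto_const_nhds
  simp only [trunc_eq_sum, map_sum, map_smul, smul_eq_mul]
  simpa using tendsto_finsetSum (Finset.range (m + 1)) fun k _ => (hx k).mul_const (w (unitVec k))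

end EllOne

section ParkingOperator

theorem parkCol_apply (i j : ℕ) : parkCol j i = parkMatrix i j := rfl

theorem parkOp_unitVec (j : ℕ) : parkOp (unitVec j) = parkCol j := by
  ext i
  refine (parkOp_hasSum (unitVec j) i).unique ?_
  simpa [unitVec_apply, parkCol_apply] using
    hasSum_single (f := fun k => parkMatrix i k * unitVec j k) j
      fun k hk => by rw [unitVec_apply, if_neg hk, mul_zero]

theorem tendsto_choose_div_two_pow (r : ℕ) :
    Tendsto (fun k : ℕ => (k.choose r : ℝ) / 2 ^ k) atTop (𝓝 0) := by
  refine squeeze_zero (fun k => by positivity) (fun k => ?_)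
    (tendsto_pow_const_div_const_pow_of_one_lt r (r := (2 : ℝ)) (by norm_num))
  gcongr
  exact_mod_cast Nat.choose_le_pow k r

theorem abs_oscillation_sub_le (s k : ℕ) :
    |(-1 : ℝ) ^ s / 2 ^ (k + 2) - 1 / (((k : ℝ) + 1) * 2 ^ (k + 1))|
      ≤ (1 / 2 + 1 / ((k : ℝ) + 1)) / 2 ^ (k + 1) := by
  refine (abs_sub _ _).trans_eq ?_
  rw [abs_div, abs_pow, abs_neg, abs_one, one_pow,
    abs_of_pos (by positivity : (0 : ℝ) < 2 ^ (k + 2)), abs_of_pos (by positivity),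
    pow_succ _ (k + 1)]
  field_simp

theorem tendsto_choose_mul_oscillation (r : ℕ) (s : ℕ → ℕ) :
    Tendsto (fun k : ℕ => ((k + 1).choose r : ℝ)
      * ((-1 : ℝ) ^ s k / 2 ^ (k + 2) - 1 / (((k : ℝ) + 1) * 2 ^ (k + 1)))) atTop (𝓝 0) := by
  have hlim := ((tendsto_choose_div_two_pow r).comp (tendsto_add_atTop_nat 1)).mul
    ((tendsto_one_div_add_atTop_nhds_zero_nat (𝕜 := ℝ)).const_add (1 / 2))
  rw [zero_mul] at hlim
  refine squeeze_zero_norm (fun k => ?_) hlim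
  rw [norm_mul, Real.norm_natCast, Function.comp_apply, div_mul_eq_mul_div, mul_div_assoc]
  exact mul_le_mul_of_nonneg_left (abs_oscillation_sub_le _ k) (Nat.cast_nonneg _)

theorem tendsto_parkMatrix_row (i : ℕ) : Tendsto (fun j => parkMatrix i j) atTop (𝓝 0) := by
  rw [← tendsto_add_atTop_iff_nat 2]
  match i with
  | 0 => exact tendsto_const_nhds
  | 1 =>
    simpa [parkMatrix, add_sub_assoc] using
      (tendsto_one_div_add_atTop_nhds_zero_nat (𝕜 := ℝ)).add
        (tendsto_choose_mul_oscillation 0 (· + 1))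
  | r + 2 => exact tendsto_choose_mul_oscillation (r + 1) (· + r)

theorem tendsto_comp_parkOp_pow_unitVec {w : EllOne →L[ℝ] ℝ}
    (hw : Tendsto (fun j => w (unitVec j)) atTop (𝓝 0)) (n : ℕ) :
    Tendsto (fun j => w.comp (parkOp ^ n) (unitVec j)) atTop (𝓝 0) := by
  induction n with
  | zero => exact hw
  | succ n ih =>
    refine (tendsto_functional_of_tendsto_apply ih parkCol_norm_le tendsto_parkMatrix_row).congr
      fun j => ?_
    rw [ContinuousLinearMap.comp_apply, ContinuousLinearMap.comp_apply, pow_succ,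
      mul_apply_eq_comp, parkOp_unitVec]

/-- The compression of the operator to the first `m + 1` coordinates. -/
noncomputable def parkTrunc (m : ℕ) : EllOne →L[ℝ] EllOne := (trunc m).comp (parkOp.comp (trunc m))

theorem tendsto_parkTrunc (x : EllOne) : Tendsto (fun m => parkTrunc m x) atTop (𝓝 (parkOp x)) :=
  tendsto_trunc_comp_trunc parkOp x

theorem tendsto_comp_parkTrunc_pow {w : EllOne →L[ℝ] ℝ}
    (hw : Tendsto (fun j => w (unitVec j)) atTop (𝓝 0)) (n : ℕ) :
    Tendsto (fun m => w.comp (parkTrunc m ^ n)) atTop (𝓝 (w.comp (parkOp ^ n))) :=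
  tendsto_functional_comp_compression_pow norm_trunc_le
    (fun n => tendsto_comp_trunc (tendsto_comp_parkOp_pow_unitVec hw n)) n

theorem parkOp_apply_zero (x : EllOne) : parkOp x 0 = x 0 / 2 - x 1 := by
  rw [← (parkOp_hasSum x 0).tsum_eq, tsum_eq_sum (s := Finset.range 2) fun j hj => ?_]
  · simp only [Finset.sum_range_succ, Finset.sum_range_zero, parkMatrix]
    ring
  · obtain ⟨k, rfl⟩ := Nat.exists_eq_add_of_le' (not_lt.1 (Finset.mem_range.not.1 hj))
    exact zero_mul _

end ParkingOperator

section WeightedSeminorm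

/-- `p` is a weighted `ℓ¹` norm; the weights are its values at the unit vectors. -/
def IsWeighted (p : Seminorm ℝ EllOne) : Prop :=
  ∀ x : EllOne, HasSum (fun j => |x j| * p (unitVec j)) (p x)

namespace IsWeighted

variable {p : Seminorm ℝ EllOne}

theorem apply_eq_sub_smul_add (hp : IsWeighted p) (x : EllOne) (i : ℕ) :
    p x = p (x - x i • unitVec i) + |x i| * p (unitVec i) := by
  rw [← sub_eq_iff_eq_add]
  refine (hasSum_ite_sub_hasSum (hp x) i).unique ((hp (x - x i • unitVec i)).congr_fun fun j => ?_)
  rw [lp.coeFn_sub, Pi.sub_apply, lp.coeFn_smul, Pi.smul_apply, unitVec_apply]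
  split_ifs with hj
  · simp [hj]
  · simp

theorem trunc_le (hp : IsWeighted p) (m : ℕ) (x : EllOne) : p (trunc m x) ≤ p x :=
  hasSum_le (fun j => mul_le_mul_of_nonneg_right (abs_trunc_le m x j) (apply_nonneg p _))
    (hp (trunc m x)) (hp x)

theorem map_le_of_unitVec (hp : IsWeighted p) (hcont : Continuous p) {T : EllOne →L[ℝ] EllOne}
    {q : ℝ} {x : EllOne} (hq : ∀ j, x j ≠ 0 → p (T (unitVec j)) ≤ q * p (unitVec j)) :
    p (T x) ≤ q * p x := by
  have hterm : ∀ j, p (x j • T (unitVec j)) ≤ q * (|x j| * p (unitVec j)) := fun j => by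
    rcases eq_or_ne (x j) 0 with hj | hj
    · simp [hj]
    · rw [map_smul_eq_mul, Real.norm_eq_abs, mul_left_comm]
      exact mul_le_mul_of_nonneg_left (hq j hj) (abs_nonneg _)
  have hTx := (hasSum_unitVec x).mapL T
  simp only [map_smul] at hTx
  have hbound := ((hp x).mul_left q)
  refine le_of_tendsto_of_tendsto' ((hcont.tendsto _).comp hTx) hbound fun s => ?_
  exact (Finset.le_sum_of_subadditive p (map_zero p).le (map_add_le_add p) s _).trans
    (Finset.sum_le_sum fun j _ => hterm j)

end IsWeighted

end WeightedSeminorm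

section LogarithmicTail

theorem summable_and_tsum_le_of_le_geometric {f : ℕ → ℝ} {B : ℝ} (hf : ∀ n, 0 ≤ f n)
    (hB : ∀ n, f n ≤ B * (1 / 3) ^ n) : Summable f ∧ ∑' n, f n ≤ 3 / 2 * B := by
  have hgeom :=
    (hasSum_geometric_of_lt_one (r := (1 / 3 : ℝ)) (by norm_num) (by norm_num)).mul_left B
  have hsum := Summable.of_nonneg_of_le hf hB hgeom.summable
  refine ⟨hsum, (hasSum_le hB hsum.hasSum hgeom).trans_eq ?_⟩
  norm_num [mul_comm]

/-- The tail `∑_{j > r} 1 / (j 3ʲ)` of the series of `log (3 / 2)`. -/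
noncomputable def logTail (r : ℕ) : ℝ := ∑' j : ℕ, 1 / (((j : ℝ) + r + 1) * 3 ^ (j + r + 1))

theorem logTail_term_le (r j : ℕ) : 1 / (((j : ℝ) + r + 1) * 3 ^ (j + r + 1)) ≤
    1 / (((r : ℝ) + 1) * 3 ^ (r + 1)) * (1 / 3 : ℝ) ^ j := by
  rw [one_div_pow, one_div_mul_one_div, mul_assoc, ← pow_add, add_assoc j, add_comm j (r + 1)]
  gcongr
  linarith [(Nat.cast_nonneg j : (0 : ℝ) ≤ j)]

theorem summable_logTail_and_logTail_le (r : ℕ) :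
    (Summable fun j : ℕ => 1 / (((j : ℝ) + r + 1) * 3 ^ (j + r + 1))) ∧
      logTail r ≤ 3 / 2 * (1 / (((r : ℝ) + 1) * 3 ^ (r + 1))) :=
  summable_and_tsum_le_of_le_geometric (fun _ => by positivity) (logTail_term_le r)

theorem logTail_nonneg (r : ℕ) : 0 ≤ logTail r := tsum_nonneg fun _ => by positivity

theorem logTail_eq_add (r : ℕ) :
    logTail r = 1 / (((r : ℝ) + 1) * 3 ^ (r + 1)) + logTail (r + 1) := by
  rw [logTail, (summable_logTail_and_logTail_le r).1.tsum_eq_zero_add, logTail]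
  congr 1
  · norm_num
  · refine tsum_congr fun j => ?_
    rw [add_right_comm j 1 r, add_assoc j r 1]
    push_cast
    ring

theorem logTail_bounds : (4053 / 10000 : ℝ) ≤ logTail 0 ∧ logTail 0 ≤ 4056 / 10000 ∧
    (720 / 10000 : ℝ) ≤ logTail 1 ∧ logTail 1 ≤ 723 / 10000 ∧
    (164 / 10000 : ℝ) ≤ logTail 2 ∧ logTail 2 ≤ 168 / 10000 := by
  have h0 := logTail_eq_add 0
  have h1 := logTail_eq_add 1
  have h2 := logTail_eq_add 2
  have h3 := logTail_eq_add 3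
  have h4 := logTail_eq_add 4
  have h5 := logTail_eq_add 5
  have h6 := (summable_logTail_and_logTail_le 6).2
  have h6' := logTail_nonneg 6
  norm_num at h0 h1 h2 h3 h4 h5 h6
  refine ⟨?_, ?_, ?_, ?_, ?_, ?_⟩ <;> linarith

theorem parkMatrix_add_two_zero (r : ℕ) :
    parkMatrix (r + 2) 0 = (-1 : ℝ) ^ (r + 1) / ((r : ℝ) + 1) * logTail r := rfl

theorem abs_parkMatrix_add_two_zero (r : ℕ) :
    |parkMatrix (r + 2) 0| = logTail r / ((r : ℝ) + 1) := by
  rw [parkMatrix_add_two_zero, abs_mul, abs_div, abs_pow, abs_neg, abs_one, one_pow,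
    abs_of_nonneg (logTail_nonneg r), abs_of_pos (by positivity : (0 : ℝ) < (r : ℝ) + 1),
    one_div_mul_eq_div]

theorem abs_parkMatrix_add_two_zero_le (s r : ℕ) : |parkMatrix (r + s + 2) 0| ≤
    3 / 2 * (1 / (((s : ℝ) + 1) ^ 2 * 3 ^ (s + 1))) * (1 / 3 : ℝ) ^ r := by
  have hsr : (s : ℝ) + 1 ≤ ((r + s : ℕ) : ℝ) + 1 := by gcongr; exact Nat.le_add_left s r
  rw [abs_parkMatrix_add_two_zero, div_le_iff₀ (by positivity)]
  calc logTail (r + s) ≤ 3 / 2 * (1 / ((((r + s : ℕ) : ℝ) + 1) * 3 ^ (r + s + 1))) :=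
        (summable_logTail_and_logTail_le (r + s)).2
    _ = 3 / 2 * (1 / (((((r + s : ℕ) : ℝ) + 1) ^ 2 * 3 ^ (s + 1)))) * (1 / 3) ^ r
          * (((r + s : ℕ) : ℝ) + 1) := by
        rw [add_assoc r s 1, pow_add, one_div_pow]
        field_simp
    _ ≤ _ := by gcongr

theorem tsum_abs_parkMatrix_zero_tail_le (s : ℕ) : ∑' r, |parkMatrix (r + s + 2) 0| ≤
    9 / 4 * (1 / (((s : ℝ) + 1) ^ 2 * 3 ^ (s + 1))) :=
  (summable_and_tsum_le_of_le_geometric (fun _ => abs_nonneg _)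
    (abs_parkMatrix_add_two_zero_le s)).2.trans_eq (by ring)

end LogarithmicTail

section ColumnEstimates

theorem ellOne_norm_eq_sum_add_tsum (x : EllOne) (n : ℕ) :
    ‖x‖ = ∑ i ∈ Finset.range n, |x i| + ∑' i, |x (i + n)| := by
  rw [ellOne_norm, (ellOne_summable x).sum_add_tsum_nat_add n]

theorem parkMatrix_eq_zero_of_lt {i j : ℕ} (hj : j ≠ 0) (hij : j < i) : parkMatrix i j = 0 := by
  match i, j with
  | _, 0 => exact absurd rfl hj
  | _ + 2, 1 => rfl
  | r + 2, k + 2 => simp only [parkMatrix, Nat.choose_eq_zero_of_lt (by omega : k + 1 < r + 1),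
      Nat.cast_zero, zero_mul]

theorem norm_parkCol_eq_sum {j : ℕ} (hj : j ≠ 0) :
    ‖parkCol j‖ = ∑ i ∈ Finset.range (j + 1), |parkMatrix i j| := by
  rw [ellOne_norm, tsum_eq_sum fun i hi => ?_]
  · rfl
  · rw [parkCol_apply, parkMatrix_eq_zero_of_lt hj (by simpa using hi), abs_zero]

theorem abs_neg_one_pow_mul_sub {a b : ℝ} (hb : 0 ≤ b) (hba : b ≤ a) (n : ℕ) :
    |(-1) ^ n * a - b| = a - (-1) ^ n * b := by
  rcases neg_one_pow_eq_or ℝ n with h | h <;> rw [h]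
  · rw [abs_of_nonneg (by linarith)]
    ring
  · rw [abs_of_nonpos (by linarith)]
    ring

theorem sum_range_choose_succ (n : ℕ) :
    ∑ r ∈ Finset.range n, (n.choose (r + 1) : ℝ) = 2 ^ n - 1 := by
  have h := (Finset.sum_range_succ' _ n).symm.trans (Nat.sum_range_choose n)
  rw [Nat.choose_zero_right] at h
  rw [eq_sub_iff_add_eq]
  exact_mod_cast h

theorem alternating_sum_range_choose_succ {n : ℕ} (hn : n ≠ 0) :
    ∑ r ∈ Finset.range n, (-1 : ℝ) ^ r * (n.choose (r + 1) : ℝ) = 1 := by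
  have h : ∑ r ∈ Finset.range (n + 1), (-1 : ℝ) ^ r * (n.choose r : ℝ) = 0 := by
    exact_mod_cast Int.alternating_sum_range_choose_of_ne hn
  rw [Finset.sum_range_succ'] at h
  simp only [pow_succ, mul_neg_one, neg_mul, Finset.sum_neg_distrib, pow_zero, one_mul,
    Nat.choose_zero_right, Nat.cast_one] at h
  linarith

theorem abs_parkMatrix_add_two_add_three (r k : ℕ) : |parkMatrix (r + 2) (k + 3)| =
    (k + 2).choose (r + 1) * (1 / 2 ^ (k + 3)) + (-1) ^ k / ((k + 2) * 2 ^ (k + 2)) *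
      ((-1) ^ r * (k + 2).choose (r + 1)) := by
  have hle : 1 / (((k : ℝ) + 2) * 2 ^ (k + 2)) ≤ 1 / 2 ^ (k + 3) := by
    rw [pow_succ' _ (k + 2)]
    gcongr
    linarith [(Nat.cast_nonneg k : (0 : ℝ) ≤ k)]
  have hentry : parkMatrix (r + 2) (k + 3) = (k + 2).choose (r + 1) *
      ((-1) ^ (k + 1 + r) * (1 / 2 ^ (k + 3)) - 1 / (((k : ℝ) + 2) * 2 ^ (k + 2))) := by
    rw [show k + 3 = k + 1 + 2 from rfl, parkMatrix, mul_one_div]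
    push_cast
    ring_nf
  rw [hentry, abs_mul, Nat.abs_cast, abs_neg_one_pow_mul_sub (by positivity) hle]
  ring

theorem sum_abs_parkMatrix_add_three_le (k : ℕ) :
    ∑ r ∈ Finset.range (k + 2), |parkMatrix (r + 2) (k + 3)| ≤ 1 / 2 := by
  simp only [abs_parkMatrix_add_two_add_three]
  rw [Finset.sum_add_distrib, ← Finset.sum_mul, ← Finset.mul_sum, sum_range_choose_succ,
    alternating_sum_range_choose_succ (by omega), mul_one]
  have hsign : (-1 : ℝ) ^ k ≤ 1 := (neg_one_pow_eq_or ℝ k).elim Eq.le fun h => by linarith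
  have hcorr : (-1 : ℝ) ^ k / ((k + 2) * 2 ^ (k + 2)) ≤ 1 / (2 * 2 ^ (k + 2)) := by
    gcongr
    linarith [(Nat.cast_nonneg k : (0 : ℝ) ≤ k)]
  have hmain : ((2 : ℝ) ^ (k + 2) - 1) * (1 / 2 ^ (k + 3)) = 1 / 2 - 1 / (2 * 2 ^ (k + 2)) := by
    rw [pow_succ _ (k + 2)]
    field_simp
  linarith

theorem norm_parkCol_add_three_le (k : ℕ) :
    ‖parkCol (k + 3)‖ ≤ |parkMatrix 1 (k + 3)| + 1 / 2 := by
  rw [norm_parkCol_eq_sum (by omega), Finset.sum_range_succ', Finset.sum_range_succ']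
  have hzero : parkMatrix 0 (k + 3) = 0 := rfl
  rw [hzero, abs_zero, add_zero, add_comm]
  exact add_le_add_right (sum_abs_parkMatrix_add_three_le k) _

theorem choose_two_le {n : ℕ} (hn : 5 ≤ n) :
    32 * n.choose 2 ≤ 10 * 2 ^ n ∧ 32 * n ≤ 10 * 2 ^ n := by
  induction n, hn using Nat.le_induction with
  | base => decide
  | succ n hn ih =>
    rw [Nat.choose_succ_succ' n 1, Nat.choose_one_right, one_add_one_eq_two, pow_succ]
    omega

theorem abs_oscillation_sub_le_of_four_le (s : ℕ) {k : ℕ} (hk : 4 ≤ k) :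
    |(-1 : ℝ) ^ s / 2 ^ (k + 2) - 1 / (((k : ℝ) + 1) * 2 ^ (k + 1))| ≤ 7 / 10 / 2 ^ (k + 1) := by
  refine (abs_oscillation_sub_le s k).trans ?_
  gcongr
  have hk' : (5 : ℝ) ≤ k + 1 := by exact_mod_cast Nat.succ_le_succ hk
  linarith [one_div_le_one_div_of_le (by norm_num) hk']

theorem abs_parkMatrix_one_le {k : ℕ} (hk : 4 ≤ k) : |parkMatrix 1 (k + 2)| ≤ 2 / 9 := by
  have hosc := abs_le.1 (abs_oscillation_sub_le_of_four_le (k + 1) hk)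
  have hk' : (5 : ℝ) ≤ k + 1 := by exact_mod_cast Nat.succ_le_succ hk
  have hdiv := one_div_le_one_div_of_le (by norm_num) hk'
  have hdiv' : (0 : ℝ) ≤ 1 / (k + 1) := by positivity
  have hpow : (7 / 10 : ℝ) / 2 ^ (k + 1) ≤ 7 / 10 / 2 ^ 5 := by
    gcongr
    · norm_num
    · omega
  norm_num at hpow
  rw [parkMatrix, abs_le]
  constructor <;> linarith

theorem abs_parkMatrix_three_le {k : ℕ} (hk : 4 ≤ k) : |parkMatrix 3 (k + 2)| ≤ 7 / 32 := by
  have hchoose : ((k + 1).choose 2 : ℝ) ≤ 10 / 32 * 2 ^ (k + 1) := by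
    have h : (32 * (k + 1).choose 2 : ℝ) ≤ 10 * 2 ^ (k + 1) := by
      exact_mod_cast (choose_two_le (n := k + 1) (by omega)).1
    linarith
  rw [parkMatrix, abs_mul, Nat.abs_cast]
  calc _ ≤ 10 / 32 * (2 : ℝ) ^ (k + 1) * (7 / 10 / 2 ^ (k + 1)) :=
        mul_le_mul hchoose (abs_oscillation_sub_le_of_four_le _ hk) (abs_nonneg _) (by positivity)
    _ = 7 / 32 := by field_simp

end ColumnEstimates

section ParkingCone

theorem dilog_neg_half_bounds :
    (-44850 / 100000 : ℝ) ≤ ∑' k : ℕ, (-1 : ℝ) ^ (k + 1) / (((k : ℝ) + 1) ^ 2 * 2 ^ (k + 1)) ∧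
    ∑' k : ℕ, (-1 : ℝ) ^ (k + 1) / (((k : ℝ) + 1) ^ 2 * 2 ^ (k + 1)) ≤ -44834 / 100000 := by
  set f : ℕ → ℝ := fun k => (-1 : ℝ) ^ (k + 1) / (((k : ℝ) + 1) ^ 2 * 2 ^ (k + 1)) with hf
  have hb : ∀ k : ℕ, ‖f (k + 8)‖ ≤ 1 / 41472 * (1 / 2 : ℝ) ^ k := fun k => by
    rw [hf, norm_div, norm_pow, norm_neg, norm_one, one_pow, Real.norm_eq_abs,
      abs_of_pos (by positivity), one_div_pow, one_div_mul_one_div]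
    refine one_div_le_one_div_of_le (by positivity) ?_
    calc (41472 : ℝ) * 2 ^ k = 9 ^ 2 * 2 ^ (k + 8 + 1) := by ring
      _ ≤ (((k + 8 : ℕ) : ℝ) + 1) ^ 2 * 2 ^ (k + 8 + 1) := by
        gcongr
        push_cast
        linarith [(Nat.cast_nonneg k : (0 : ℝ) ≤ k)]
  have hgeom := (hasSum_geometric_of_lt_one (r := (1 / 2 : ℝ)) (by norm_num) (by norm_num)).mul_left
    (1 / 41472)
  have hs : Summable f := (summable_nat_add_iff 8).1 (.of_norm_bounded hgeom.summable hb)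
  have htail := abs_le.1 (tsum_of_norm_bounded hgeom hb)
  rw [← hs.sum_add_tsum_nat_add 8]
  simp only [Finset.sum_range_succ, Finset.sum_range_zero, hf] at htail ⊢
  norm_num at htail ⊢
  constructor <;> linarith [htail.1, htail.2]

theorem parkMatrix_one_zero_bounds :
    (273 / 10000 : ℝ) ≤ parkMatrix 1 0 ∧ parkMatrix 1 0 ≤ 276 / 10000 := by
  obtain ⟨hdilog, hdilog'⟩ := dilog_neg_half_bounds
  rw [parkMatrix]
  constructor <;> nlinarith [Real.log_two_gt_d9, Real.log_two_lt_d9, Real.pi_gt_d4, Real.pi_lt_d4]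

/-- The norm `‖x‖ + 9/10 |x₁| + 2/5 |x₃|`, in which the growth of the operator on the hyperplane
`x₁ = 0` stays below its dominant eigenvalue. The extra weight at `1` makes the cone around
`unitVec 1` wide enough to contain an approximate eigenvector, the one at `3` absorbs the
large column `3`. -/
noncomputable def parkSeminorm : Seminorm ℝ EllOne :=
  normSeminorm ℝ EllOne +
    (9 / 10 : NNReal) • (normSeminorm ℝ ℝ).comp (lp.evalCLM ℝ (fun _ : ℕ => ℝ) 1 1).toLinearMap +
    (2 / 5 : NNReal) • (normSeminorm ℝ ℝ).comp (lp.evalCLM ℝ (fun _ : ℕ => ℝ) 1 3).toLinearMap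

theorem parkSeminorm_apply (x : EllOne) :
    parkSeminorm x = ‖x‖ + 9 / 10 * |x 1| + 2 / 5 * |x 3| := by
  change ‖x‖ + ((9 / 10 : NNReal) : ℝ) * |x 1| + ((2 / 5 : NNReal) : ℝ) * |x 3| = _
  norm_num

theorem parkSeminorm_unitVec (j : ℕ) : parkSeminorm (unitVec j) =
    1 + 9 / 10 * (if j = 1 then 1 else 0) + 2 / 5 * (if j = 3 then 1 else 0) := by
  simp only [parkSeminorm_apply, norm_unitVec, unitVec_apply, eq_comm (b := j), apply_ite abs,
    abs_one, abs_zero]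

theorem isWeighted_parkSeminorm : IsWeighted parkSeminorm := fun x => by
  have hnorm := (ellOne_summable x).hasSum
  rw [← ellOne_norm] at hnorm
  have hcoord : ∀ i, HasSum (fun j => if j = i then |x j| else 0) |x i| := fun i => by
    simpa using hasSum_single (f := fun j => if j = i then |x j| else 0) i fun j hj => if_neg hj
  rw [parkSeminorm_apply]
  refine ((hnorm.add ((hcoord 1).mul_left (9 / 10))).add ((hcoord 3).mul_left (2 / 5))).congr_fun
    fun j => ?_
  rw [parkSeminorm_unitVec]
  split_ifs <;> ring

theorem continuous_parkSeminorm : Continuous parkSeminorm := by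
  have hcoord := fun i => (lp.evalCLM ℝ (fun _ : ℕ => ℝ) 1 i).continuous.abs
  exact ((continuous_norm.add ((hcoord 1).const_mul (9 / 10))).add
    ((hcoord 3).const_mul (2 / 5))).congr fun x => (parkSeminorm_apply x).symm

theorem abs_apply_le_norm (x : EllOne) (i : ℕ) : |x i| ≤ ‖x‖ := by
  rw [ellOne_norm]
  exact (ellOne_summable x).le_tsum i fun _ _ => abs_nonneg _

theorem norm_le_parkSeminorm (x : EllOne) : ‖x‖ ≤ parkSeminorm x := by
  rw [parkSeminorm_apply]
  linarith [abs_nonneg (x 1), abs_nonneg (x 3)]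

theorem parkSeminorm_le_norm (x : EllOne) : parkSeminorm x ≤ 23 / 10 * ‖x‖ := by
  rw [parkSeminorm_apply]
  linarith [abs_apply_le_norm x 1, abs_apply_le_norm x 3]

theorem parkSeminorm_parkCol_zero_le : parkSeminorm (parkCol 0) ≤ 21 / 20 := by
  have htail := tsum_abs_parkMatrix_zero_tail_le 2
  obtain ⟨-, hlog0, -, hlog1, -, -⟩ := logTail_bounds
  obtain ⟨hpos, hle⟩ := parkMatrix_one_zero_bounds
  have hzero : parkMatrix 0 0 = 1 / 2 := rfl
  rw [parkSeminorm_apply, ellOne_norm_eq_sum_add_tsum _ 4]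
  simp only [Finset.sum_range_succ, Finset.sum_range_zero, parkCol_apply, hzero,
    abs_parkMatrix_add_two_zero 0, abs_parkMatrix_add_two_zero 1,
    abs_of_nonneg (by linarith : 0 ≤ parkMatrix 1 0)]
  norm_num at htail ⊢
  linarith

theorem parkSeminorm_parkCol_le {j : ℕ} (hj : j ≠ 1) :
    parkSeminorm (parkCol j) ≤ 21 / 20 * parkSeminorm (unitVec j) := by
  rw [parkSeminorm_unitVec]
  match j with
  | 0 => simpa using parkSeminorm_parkCol_zero_le
  | 1 => exact absurd rfl hj
  | 2 | 3 | 4 | 5 =>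
    rw [parkSeminorm_apply, norm_parkCol_eq_sum (by norm_num)]
    norm_num [Finset.sum_range_succ, parkCol_apply, parkMatrix, Nat.choose, abs_of_pos, abs_of_neg]
  | k + 6 =>
    have h1 : |parkMatrix 1 (k + 6)| ≤ 2 / 9 := abs_parkMatrix_one_le (Nat.le_add_left 4 k)
    have h3 : |parkMatrix 3 (k + 6)| ≤ 7 / 32 := abs_parkMatrix_three_le (Nat.le_add_left 4 k)
    have hnorm := norm_parkCol_add_three_le (k + 3)
    rw [parkSeminorm_apply, parkCol_apply, parkCol_apply, if_neg (by omega), if_neg (by omega)]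
    linarith

/-- A rational approximation of the dominant eigenvector, normalized by its entry of index `1`. -/
noncomputable def approxEigen : EllOne :=
  (-15 / 11 : ℝ) • unitVec 0 + unitVec 1 + (97 / 250 : ℝ) • unitVec 2 +
    (-21 / 500 : ℝ) • unitVec 3 + (13 / 2000 : ℝ) • unitVec 4

theorem approxEigen_apply (i : ℕ) : approxEigen i =
    match i with
    | 0 => -15 / 11
    | 1 => 1
    | 2 => 97 / 250
    | 3 => -21 / 500
    | 4 => 13 / 2000
    | _ + 5 => 0 := by
  simp only [approxEigen, lp.coeFn_add, lp.coeFn_smul, Pi.add_apply, Pi.smul_apply, unitVec_apply,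
    smul_eq_mul]
  match i with
  | 0 | 1 | 2 | 3 | 4 | _ + 5 => simp

theorem trunc_approxEigen {m : ℕ} (hm : 4 ≤ m) : trunc m approxEigen = approxEigen := by
  simp only [approxEigen, map_add, map_smul, trunc_unitVec (show 0 ≤ m by omega),
    trunc_unitVec (show 1 ≤ m by omega), trunc_unitVec (show 2 ≤ m by omega),
    trunc_unitVec (show 3 ≤ m by omega), trunc_unitVec hm]

theorem parkOp_approxEigen_apply (i : ℕ) : parkOp approxEigen i =
    -15 / 11 * parkMatrix i 0 + parkMatrix i 1 + 97 / 250 * parkMatrix i 2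
      + -21 / 500 * parkMatrix i 3 + 13 / 2000 * parkMatrix i 4 := by
  simp only [approxEigen, map_add, map_smul, parkOp_unitVec]
  rfl

theorem parkOp_approxEigen_add_five (i : ℕ) :
    parkOp approxEigen (i + 5) = -15 / 11 * parkMatrix (i + 3 + 2) 0 := by
  rw [parkOp_approxEigen_apply, parkMatrix_eq_zero_of_lt one_ne_zero (by omega),
    parkMatrix_eq_zero_of_lt two_ne_zero (by omega),
    parkMatrix_eq_zero_of_lt three_ne_zero (by omega),
    parkMatrix_eq_zero_of_lt four_ne_zero (by omega)]
  simp only [mul_zero, add_zero]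

theorem parkOp_approxEigen_one_bounds :
    (1233 / 1000 : ℝ) ≤ parkOp approxEigen 1 ∧ parkOp approxEigen 1 ≤ 12335 / 10000 := by
  obtain ⟨hA, hA'⟩ := parkMatrix_one_zero_bounds
  rw [parkOp_approxEigen_apply]
  generalize parkMatrix 1 0 = A at hA hA' ⊢
  norm_num [parkMatrix]
  constructor <;> linarith [Real.log_two_gt_d9, Real.log_two_lt_d9]

theorem parkSeminorm_residual_le :
    parkSeminorm (parkOp approxEigen - parkOp approxEigen 1 • approxEigen) ≤ 6 / 1000 := by
  obtain ⟨hrate, hrate'⟩ := parkOp_approxEigen_one_bounds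
  obtain ⟨h0, h0', h1, h1', h2, h2'⟩ := logTail_bounds
  set a := parkOp approxEigen 1 with ha
  set R := parkOp approxEigen - a • approxEigen
  have hRi : ∀ i, R i = parkOp approxEigen i - a * approxEigen i := fun i => rfl
  have hone : R 1 = 0 := by rw [hRi, ← ha, approxEigen_apply, mul_one, sub_self]
  have htail : ∀ i, |R (i + 5)| = 15 / 11 * |parkMatrix (i + 3 + 2) 0| := fun i => by
    rw [hRi, parkOp_approxEigen_add_five, approxEigen_apply, mul_zero, sub_zero, abs_mul]
    norm_num [abs_of_neg]
  simp only [parkOp_approxEigen_apply, approxEigen_apply] at hRi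
  have hzero : |R 0| ≤ 5 / 10000 := by
    rw [hRi, abs_le]
    norm_num [parkMatrix]
    constructor <;> linarith
  have htwo : |R 2| ≤ 16 / 10000 := by
    rw [hRi, parkMatrix_add_two_zero 0, abs_le]
    norm_num [parkMatrix]
    constructor <;> linarith
  have hthree : |R 3| ≤ 7 / 10000 := by
    rw [hRi, parkMatrix_add_two_zero 1, abs_le]
    norm_num [parkMatrix, Nat.choose]
    constructor <;> linarith
  have hfour : |R 4| ≤ 5 / 10000 := by
    rw [hRi, parkMatrix_add_two_zero 2, abs_le]
    norm_num [parkMatrix, Nat.choose]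
    constructor <;> linarith
  have hsum := tsum_abs_parkMatrix_zero_tail_le 3
  rw [parkSeminorm_apply, ellOne_norm_eq_sum_add_tsum R 5]
  simp only [htail, tsum_mul_left, Finset.sum_range_succ, Finset.sum_range_zero, hone, abs_zero]
  norm_num at hsum ⊢
  linarith

theorem parkSeminorm_approxEigen_sub_le :
    parkSeminorm (approxEigen - unitVec 1) ≤ 186 / 100 - 1 / 25 := by
  rw [parkSeminorm_apply, ellOne_norm_eq_sum_add_tsum _ 5]
  have htail : ∀ i, (approxEigen - unitVec 1 : EllOne) (i + 5) = 0 := fun i => by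
    rw [lp.coeFn_sub, Pi.sub_apply, approxEigen_apply, unitVec_apply, if_neg (by omega), sub_zero]
  simp only [htail, abs_zero, tsum_zero]
  norm_num [Finset.sum_range_succ, approxEigen_apply, unitVec_apply, abs_of_pos, abs_of_neg]

/-- The cone around `approxEigen` used for the infinite matrix and for all its large blocks. -/
noncomputable def parkFrame : ConeFrame EllOne where
  p := parkSeminorm
  φ := lp.evalCLM ℝ (fun _ : ℕ => ℝ) 1 1
  e := unitVec 1
  v₀ := approxEigen
  q := 21 / 20
  l := 6 / 5
  δ := 1 / 25
  C := 23 / 10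
  norm_le := norm_le_parkSeminorm
  le_norm := parkSeminorm_le_norm
  φ_e := unitVec_apply 1 1
  φ_v₀ := approxEigen_apply 1
  split x := isWeighted_parkSeminorm.apply_eq_sub_smul_add x 1
  q_pos := by norm_num
  q_lt_l := by norm_num
  δ_nonneg := by norm_num
  center := by
    norm_num [parkSeminorm_unitVec]
    linarith [parkSeminorm_approxEigen_sub_le]

theorem parkFrame_contracts_parkOp : parkFrame.Contracts parkOp where
  contr _ hk := isWeighted_parkSeminorm.map_le_of_unitVec continuous_parkSeminorm fun j hj => by
    rw [parkOp_unitVec]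
    refine parkSeminorm_parkCol_le ?_
    rintro rfl
    exact hj hk
  residual := parkSeminorm_residual_le.trans (by norm_num [parkFrame])
  lower := le_trans (by norm_num [parkFrame, parkSeminorm_unitVec]) parkOp_approxEigen_one_bounds.1

theorem parkFrame_contracts_parkTrunc {m : ℕ} (hm : 4 ≤ m) : parkFrame.Contracts (parkTrunc m) :=
  parkFrame_contracts_parkOp.compression (isWeighted_parkSeminorm.trunc_le m)
    (fun x => (trunc_apply m x 1).trans (if_pos (by omega))) (trunc_approxEigen hm)

end ParkingCone

section Matrices

variable {n : Type*} [Fintype n]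

/-- A square real matrix as an operator on column vectors; the sup norm that `n → ℝ` carries is
immaterial here. -/
noncomputable def mulVecCLM (M : Matrix n n ℝ) : (n → ℝ) →L[ℝ] (n → ℝ) :=
  LinearMap.toContinuousLinearMap M.mulVecLin

theorem mulVecCLM_apply (M : Matrix n n ℝ) (x : n → ℝ) : mulVecCLM M x = M.mulVec x := rfl

variable [DecidableEq n]

/-- The row vector of a functional on column vectors. -/
def rowVec (w : (n → ℝ) →L[ℝ] ℝ) : n → ℝ := fun i => w (Pi.single i 1)

theorem rowVec_dotProduct (w : (n → ℝ) →L[ℝ] ℝ) (x : n → ℝ) : rowVec w ⬝ᵥ x = w x := by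
  conv_rhs => rw [pi_eq_sum_univ' x, map_sum]
  exact Finset.sum_congr rfl fun i _ => by rw [map_smul, smul_eq_mul, mul_comm]; rfl

omit [Fintype n] in
theorem exists_rowVec_eq [Finite n] (y : n → ℝ) : ∃ w : (n → ℝ) →L[ℝ] ℝ, rowVec w = y := by
  cases nonempty_fintype n
  exact ⟨LinearMap.toContinuousLinearMap (dotProductBilin ℝ ℝ y),
      funext fun i => dotProduct_single_one y i⟩

theorem vecMul_rowVec_eq_smul_iff {M : Matrix n n ℝ} {w : (n → ℝ) →L[ℝ] ℝ} {μ : ℝ} :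
    Matrix.vecMul (rowVec w) M = μ • rowVec w ↔ ∀ x, w (mulVecCLM M x) = μ * w x := by
  simp only [← rowVec_dotProduct, mulVecCLM_apply, Matrix.dotProduct_mulVec, ← smul_eq_mul,
    ← smul_dotProduct]
  exact dotProduct_eq_iff.symm

theorem mem_spectrum_iff_exists_mulVec {K : Type*} [Field K] {M : Matrix n n K} {z : K} :
    z ∈ spectrum K M ↔ ∃ x ≠ 0, M.mulVec x = z • x := by
  simp only [← Matrix.spectrum_toLin', ← Module.End.hasEigenvalue_iff_mem_spectrum,
    Module.End.hasEigenvalue_iff, Submodule.ne_bot_iff, Module.End.mem_eigenspace_iff,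
    Matrix.toLin'_apply, and_comm]

theorem ofReal_mem_spectrum {M : Matrix n n ℝ} {μ : ℝ} {x : n → ℝ} (hx : x ≠ 0)
    (h : M.mulVec x = μ • x) : (μ : ℂ) ∈ spectrum ℂ (M.map (algebraMap ℝ ℂ)) := by
  refine mem_spectrum_iff_exists_mulVec.2 ⟨fun i => (x i : ℂ), fun h₀ => hx ?_, ?_⟩
  · exact funext fun i => Complex.ofReal_eq_zero.1 (congrFun h₀ i)
  · ext i
    simpa [Matrix.mulVec, dotProduct] using congrArg ((↑) : ℝ → ℂ) (congrFun h i)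

theorem exists_re_im_of_mem_spectrum {M : Matrix n n ℝ} {z : ℂ}
    (hz : z ∈ spectrum ℂ (M.map (algebraMap ℝ ℂ))) :
    ∃ a b, (a ≠ 0 ∨ b ≠ 0) ∧ mulVecCLM M a = z.re • a - z.im • b ∧
      mulVecCLM M b = z.im • a + z.re • b := by
  obtain ⟨x, hx₀, hx⟩ := mem_spectrum_iff_exists_mulVec.1 hz
  refine ⟨fun i => (x i).re, fun i => (x i).im, ?_, ?_, ?_⟩
  · by_contra! h
    exact hx₀ (funext fun i => Complex.ext (congrFun h.1 i) (congrFun h.2 i))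
  · ext i
    simpa [mulVecCLM_apply, Matrix.mulVec, dotProduct, Complex.re_sum] using
      congrArg Complex.re (congrFun hx i)
  · ext i
    simpa [mulVecCLM_apply, Matrix.mulVec, dotProduct, Complex.im_sum, add_comm] using
      congrArg Complex.im (congrFun hx i)

namespace HasSpectralGap

variable {M : Matrix n n ℝ} {q μ : ℝ} {v : n → ℝ} {w : (n → ℝ) →L[ℝ] ℝ}

theorem norm_le_of_mem_spectrum (h : HasSpectralGap (mulVecCLM M) q μ v w) {z : ℂ}
    (hz : z ∈ spectrum ℂ (M.map (algebraMap ℝ ℂ))) (hne : z ≠ μ) : ‖z‖ ≤ q := by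
  obtain ⟨a, b, hab, ha, hb⟩ := exists_re_im_of_mem_spectrum hz
  exact h.norm_le_of_complex_eigen hab ha hb hne

theorem eigenvalue_unique (h : HasSpectralGap (mulVecCLM M) q μ v w) {μ' : ℝ} {x : n → ℝ}
    (hx₀ : x ≠ 0) (hx : M.mulVec x = μ' • x)
    (hdom : ∀ z ∈ spectrum ℂ (M.map (algebraMap ℝ ℂ)), z ≠ μ' → ‖z‖ < |μ'|) : μ' = μ := by
  by_contra hne
  have hle := h.norm_le_of_mem_spectrum (ofReal_mem_spectrum hx₀ hx) (by exact_mod_cast hne)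
  have hlt := hdom μ (ofReal_mem_spectrum h.right_ne_zero h.right_eigen)
    (by exact_mod_cast Ne.symm hne)
  rw [Complex.norm_real, Real.norm_eq_abs] at hle hlt
  linarith [le_abs_self μ, h.rate_lt]

end HasSpectralGap

end Matrices

section FiniteBlocks

theorem HasSpectralGap.isPrincipalTriple_iff {m : ℕ} {q μ : ℝ} {v : Fin (m + 1) → ℝ}
    {w : (Fin (m + 1) → ℝ) →L[ℝ] ℝ} (h : HasSpectralGap (mulVecCLM (parkBlock m)) q μ v w)
    (hv : v 0 ≠ 0) (hw : rowVec w 0 ≠ 0) {μ' : ℝ} {v' w' : Fin (m + 1) → ℝ} :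
    IsPrincipalTriple m μ' v' w' ↔
      μ' = μ ∧ v' = (v 0)⁻¹ • v ∧ w' = (rowVec w 0)⁻¹ • rowVec w := by
  constructor
  · intro ht
    obtain rfl : μ' = μ := h.eigenvalue_unique (fun h₀ => by simpa [h₀] using ht.right_zero)
      ht.right_eigen ht.dominant
    obtain ⟨y, rfl⟩ := exists_rowVec_eq w'
    have hv' := h.right_unique ht.right_eigen
    have hy : rowVec y = y v • rowVec w :=
      congrArg rowVec (h.left_unique (vecMul_rowVec_eq_smul_iff.1 ht.left_eigen))
    refine ⟨rfl, ?_, ?_⟩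
    · have hzero := ht.right_zero
      rw [hv'] at hzero
      rw [hv', eq_inv_of_mul_eq_one_left hzero]
    · have hzero := ht.left_zero
      rw [hy] at hzero
      rw [hy, eq_inv_of_mul_eq_one_left hzero]
  · rintro ⟨rfl, rfl, rfl⟩
    refine ⟨?_, ?_, inv_mul_cancel₀ hv, inv_mul_cancel₀ hw, fun z hz hne => ?_⟩
    · rw [Matrix.mulVec_smul, smul_comm, ← h.right_eigen, mulVecCLM_apply]
    · rw [Matrix.smul_vecMul, vecMul_rowVec_eq_smul_iff.2 h.left_eigen, smul_comm]
    · exact (h.norm_le_of_mem_spectrum hz hne).trans_lt (h.rate_lt.trans_le (le_abs_self _))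

theorem padZero_apply (p : ℝ≥0∞) {m : ℕ} (x : Fin (m + 1) → ℝ) (j : ℕ) :
    padZero p x j = if h : j < m + 1 then x ⟨j, h⟩ else 0 := by
  rw [padZero, lp.coeFn_sum, Finset.sum_apply]
  simp only [lp.single_apply, Pi.single_apply]
  split_ifs with h
  · exact (Fintype.sum_eq_single ⟨j, h⟩ fun i hi => if_neg fun hij => hi (Fin.ext hij.symm)).trans
      (if_pos rfl)
  · exact Finset.sum_eq_zero fun i _ => if_neg (by omega)

/-- The inclusion `ℝ^(m + 1) → ℓ¹` given by padding with zeros. -/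
noncomputable def extend (m : ℕ) : (Fin (m + 1) → ℝ) →L[ℝ] EllOne :=
  ∑ i : Fin (m + 1), (ContinuousLinearMap.proj i).smulRight (unitVec i)

/-- The first `m + 1` coordinates of a sequence. -/
noncomputable def restrict (m : ℕ) : EllOne →L[ℝ] (Fin (m + 1) → ℝ) :=
  ContinuousLinearMap.pi fun i => lp.evalCLM ℝ (fun _ : ℕ => ℝ) 1 (i : ℕ)

theorem extend_apply {m : ℕ} (x : Fin (m + 1) → ℝ) : extend m x = padZero 1 x := by
  simp only [extend, padZero, sum_apply, single_eq_smul_unitVec]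
  rfl

theorem restrict_apply {m : ℕ} (x : EllOne) (i : Fin (m + 1)) : restrict m x i = x i := rfl

theorem restrict_extend {m : ℕ} (x : Fin (m + 1) → ℝ) : restrict m (extend m x) = x := by
  ext i
  rw [restrict_apply, extend_apply, padZero_apply, dif_pos i.2]

theorem extend_restrict (m : ℕ) (x : EllOne) : extend m (restrict m x) = trunc m x := by
  ext j
  rw [extend_apply, padZero_apply, trunc_apply]
  simp only [Nat.lt_succ_iff]
  split_ifs <;> rfl

theorem extend_single {m : ℕ} (i : Fin (m + 1)) : extend m (Pi.single i 1) = unitVec i := by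
  ext j
  rw [extend_apply, padZero_apply, unitVec_apply]
  simp only [Pi.single_apply, Fin.ext_iff]
  split_ifs <;> first | rfl | omega

theorem restrict_parkOp_extend {m : ℕ} (x : Fin (m + 1) → ℝ) :
    restrict m (parkOp (extend m x)) = mulVecCLM (parkBlock m) x := by
  suffices (restrict m).comp (parkOp.comp (extend m)) = mulVecCLM (parkBlock m) from
    congrArg (fun T => T x) this
  refine ContinuousLinearMap.coe_injective (LinearMap.pi_ext' fun j => LinearMap.ext_ring ?_)
  ext i
  simp [extend_single, parkOp_unitVec, restrict_apply, mulVecCLM_apply, parkBlock, parkCol_apply]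

theorem parkTrunc_apply_eq_extend (m : ℕ) (x : EllOne) :
    parkTrunc m x = extend m (mulVecCLM (parkBlock m) (restrict m x)) := by
  rw [← restrict_parkOp_extend, extend_restrict, extend_restrict]
  rfl

theorem HasSpectralGap.mulVecCLM_parkBlock {m : ℕ} {q μ : ℝ} {v : EllOne} {w : EllOne →L[ℝ] ℝ}
    (h : HasSpectralGap (parkTrunc m) q μ v w) :
    HasSpectralGap (mulVecCLM (parkBlock m)) q μ (restrict m v) (w.comp (extend m)) :=
  h.of_factorization restrict_extend (parkTrunc_apply_eq_extend m)

theorem rowVec_comp_extend {m : ℕ} (w : EllOne →L[ℝ] ℝ) (i : Fin (m + 1)) :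
    rowVec (w.comp (extend m)) i = w (unitVec i) :=
  congrArg w (extend_single i)

theorem trunc_trunc (m : ℕ) (x : EllOne) : trunc m (trunc m x) = trunc m x := by
  rw [← extend_restrict, ← extend_restrict, restrict_extend]

theorem trunc_eq_of_parkTrunc_eq_smul {m : ℕ} {μ : ℝ} {v : EllOne} (hμ : μ ≠ 0)
    (hv : parkTrunc m v = μ • v) : trunc m v = v := by
  refine smul_right_injective EllOne hμ ?_
  simp only [← map_smul, ← hv]
  exact trunc_trunc m _

theorem padZero_rowVec_comp_extend {m : ℕ} {μ : ℝ} {w : EllOne →L[ℝ] ℝ} (hμ : μ ≠ 0)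
    (hw : ∀ x, w (parkTrunc m x) = μ * w x) :
    padZero ∞ (rowVec (w.comp (extend m))) = dualSeq w := by
  ext j
  rw [padZero_apply, dualSeq_apply]
  split_ifs with hj
  · exact rowVec_comp_extend w ⟨j, hj⟩
  · have hzero : trunc m (unitVec j) = 0 := by
      ext i
      rw [trunc_apply, unitVec_apply]
      split_ifs <;> first | rfl | omega
    refine ((mul_eq_zero.1 ?_).resolve_left hμ).symm
    rw [← hw, parkTrunc, ContinuousLinearMap.comp_apply, ContinuousLinearMap.comp_apply, hzero]
    simp only [map_zero]

theorem padZero_smul (p : ℝ≥0∞) {m : ℕ} (c : ℝ) (x : Fin (m + 1) → ℝ) :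
    padZero p (c • x) = c • padZero p x := by
  ext j
  rw [lp.coeFn_smul, Pi.smul_apply, padZero_apply, padZero_apply]
  split_ifs
  exacts [rfl, (smul_zero c).symm]

end FiniteBlocks

section PrincipalEigenvectors

variable {T : EllOne →L[ℝ] EllOne} {μ : ℝ} {v : EllOne} {w : EllOne →L[ℝ] ℝ}

theorem parkCol_one : parkCol 1 = (1 / 2 + Real.log 2) • unitVec 1 - unitVec 0 := by
  ext i
  rw [parkCol_apply, lp.coeFn_sub, Pi.sub_apply, lp.coeFn_smul, Pi.smul_apply, unitVec_apply,
    unitVec_apply]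
  match i with
  | 0 => simp [parkMatrix]
  | 1 => simp [parkMatrix]
  | _ + 2 => simp [parkMatrix]

theorem parkTrunc_apply_zero {m : ℕ} (hm : 1 ≤ m) (x : EllOne) :
    parkTrunc m x 0 = x 0 / 2 - x 1 := by
  rw [parkTrunc, ContinuousLinearMap.comp_apply, ContinuousLinearMap.comp_apply, trunc_apply,
    if_pos m.zero_le, parkOp_apply_zero, trunc_apply, trunc_apply, if_pos m.zero_le, if_pos hm]

theorem parkTrunc_unitVec_one {m : ℕ} (hm : 1 ≤ m) : parkTrunc m (unitVec 1) = parkCol 1 := by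
  rw [parkTrunc, ContinuousLinearMap.comp_apply, ContinuousLinearMap.comp_apply,
    trunc_unitVec hm, parkOp_unitVec, parkCol_one, map_sub, map_smul, trunc_unitVec hm,
    trunc_unitVec m.zero_le]

theorem right_zero_neg (h : parkFrame.IsPrincipal T μ v w) (hT : ∀ x, T x 0 = x 0 / 2 - x 1) :
    v 0 < 0 := by
  have hzero : μ * v 0 = v 0 / 2 - v 1 := by rw [← hT, h.right_eigen]; rfl
  have hone : v 1 = 1 := h.mem_base.1
  have hμ : 6 / 5 ≤ μ := h.le_eigenvalue
  nlinarith

theorem left_zero_neg (h : parkFrame.IsPrincipal T μ v w) (hT : parkFrame.Contracts T)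
    (hcol : T (unitVec 1) = parkCol 1) : w (unitVec 0) < 0 := by
  have hzero : w (unitVec 0) = (1 / 2 + Real.log 2 - μ) * w (unitVec 1) := by
    have := h.left_eigen (unitVec 1)
    rw [hcol, parkCol_one, map_sub, map_smul, smul_eq_mul] at this
    linarith
  have hμ : 6 / 5 ≤ μ := h.le_eigenvalue
  have hone : 0 < w (unitVec 1) := h.left_e_pos hT
  rw [hzero]
  exact mul_neg_of_neg_of_pos (by linarith [Real.log_two_lt_d9]) hone

theorem isPrincipalTriple_iff {m : ℕ} (hm : 4 ≤ m)
    (h : parkFrame.IsPrincipal (parkTrunc m) μ v w) {μ' : ℝ} {v' w' : Fin (m + 1) → ℝ} :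
    IsPrincipalTriple m μ' v' w' ↔ μ' = μ ∧ v' = (v 0)⁻¹ • restrict m v ∧
      w' = (w (unitVec 0))⁻¹ • rowVec (w.comp (extend m)) := by
  have hT := parkFrame_contracts_parkTrunc hm
  have hw₀ := rowVec_comp_extend (m := m) w 0
  rw [(h.hasSpectralGap hT).mulVecCLM_parkBlock.isPrincipalTriple_iff
    (right_zero_neg h (parkTrunc_apply_zero (by omega))).ne
    (hw₀ ▸ (left_zero_neg h hT (parkTrunc_unitVec_one (by omega))).ne), hw₀]
  rfl

theorem existsUnique_isPrincipalTriple {m : ℕ} (hm : 4 ≤ m) :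
    ∃! t : ℝ × (Fin (m + 1) → ℝ) × (Fin (m + 1) → ℝ), IsPrincipalTriple m t.1 t.2.1 t.2.2 := by
  obtain ⟨μ, v, w, h⟩ := (parkFrame_contracts_parkTrunc hm).exists_isPrincipal
  refine ⟨(μ, _, _), (isPrincipalTriple_iff hm h).2 ⟨rfl, rfl, rfl⟩, fun t ht => ?_⟩
  obtain ⟨hμ, hv, hw⟩ := (isPrincipalTriple_iff hm h).1 ht
  exact Prod.ext hμ (Prod.ext hv hw)

theorem padded_eq_of_isPrincipalTriple {m : ℕ} (hm : 4 ≤ m)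
    (h : parkFrame.IsPrincipal (parkTrunc m) μ v w) {μ' : ℝ} {v' w' : Fin (m + 1) → ℝ}
    (ht : IsPrincipalTriple m μ' v' w') :
    μ' = μ ∧ padZero 1 v' = (v 0)⁻¹ • v ∧
      padZero ∞ w' = dualSeq ((w (unitVec 0))⁻¹ • w) := by
  obtain ⟨rfl, rfl, rfl⟩ := (isPrincipalTriple_iff hm h).1 ht
  have hμ := h.eigenvalue_pos.ne'
  refine ⟨rfl, ?_, ?_⟩
  · rw [padZero_smul, ← extend_apply, extend_restrict,
      trunc_eq_of_parkTrunc_eq_smul hμ h.right_eigen]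
  · rw [padZero_smul, padZero_rowVec_comp_extend hμ h.left_eigen, map_smul]

theorem tendsto_isPrincipal (h : parkFrame.IsPrincipal parkOp μ v w) {μm : ℕ → ℝ}
    {vm : ℕ → EllOne} {wm : ℕ → EllOne →L[ℝ] ℝ}
    (hm : ∀ᶠ m in atTop, parkFrame.IsPrincipal (parkTrunc m) (μm m) (vm m) (wm m)) :
    Tendsto μm atTop (𝓝 μ) ∧ Tendsto vm atTop (𝓝 v) ∧ Tendsto wm atTop (𝓝 w) := by
  have hT : ∀ᶠ m in atTop, parkFrame.Contracts (parkTrunc m) :=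
    (eventually_ge_atTop 4).mono fun _ => parkFrame_contracts_parkTrunc
  have hφ : Tendsto (fun j => parkFrame.φ (unitVec j)) atTop (𝓝 0) :=
    tendsto_const_nhds.congr' <| (eventually_gt_atTop 1).mono fun j hj =>
      ((unitVec_apply j 1).trans (if_neg hj.ne)).symm
  have hpow := tendsto_comp_parkTrunc_pow hφ
  have hvlim := ConeFrame.tendsto_right_eigenvector hT hm h (tendsto_parkTrunc v)
  have hμlim := ConeFrame.tendsto_eigenvalue hm h (by simpa only [pow_one] using hpow 1) hvlim
  exact ⟨hμlim, hvlim, ConeFrame.tendsto_left_eigenvector hT hm h hpow hμlim⟩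

theorem tendsto_of_isPrincipalTriple (h : parkFrame.IsPrincipal parkOp μ v w) {lamSeq : ℕ → ℝ}
    {vSeq wSeq : (m : ℕ) → Fin (m + 1) → ℝ}
    (hseq : ∀ᶠ m in atTop, IsPrincipalTriple m (lamSeq m) (vSeq m) (wSeq m)) :
    Tendsto lamSeq atTop (𝓝 μ) ∧
      Tendsto (fun m => padZero 1 (vSeq m)) atTop (𝓝 ((v 0)⁻¹ • v)) ∧
      Tendsto (fun m => padZero ∞ (wSeq m)) atTop (𝓝 (dualSeq ((w (unitVec 0))⁻¹ • w))) := by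
  choose! μm vm wm hprincipal using fun m (hm : 4 ≤ m) =>
    (parkFrame_contracts_parkTrunc hm).exists_isPrincipal
  have hm := (eventually_ge_atTop 4).mono hprincipal
  obtain ⟨hμlim, hvlim, hwlim⟩ := tendsto_isPrincipal h hm
  have hv₀ := ((lp.evalCLM ℝ (fun _ : ℕ => ℝ) 1 0).continuous.tendsto v).comp hvlim
  have hw₀ := ((ContinuousLinearMap.apply ℝ ℝ (unitVec 0)).continuous.tendsto w).comp hwlim
  have heq := (hseq.and (hm.and (eventually_ge_atTop 4))).mono fun m hmm =>
    padded_eq_of_isPrincipalTriple hmm.2.2 hmm.2.1 hmm.1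
  refine ⟨hμlim.congr' (heq.mono fun _ hmm => hmm.1.symm),
    ((hv₀.inv₀ (right_zero_neg h parkOp_apply_zero).ne).smul hvlim).congr'
      (heq.mono fun _ hmm => hmm.2.1.symm),
    ((dualSeq.continuous.tendsto _).comp ((hw₀.inv₀ ?_).smul hwlim)).congr'
      (heq.mono fun _ hmm => hmm.2.2.symm)⟩
  exact (left_zero_neg h parkFrame_contracts_parkOp (parkOp_unitVec 1)).ne

theorem hasSum_dualSeq_mul_parkMatrix (hw : ∀ x, w (parkOp x) = μ * w x) (j : ℕ) :
    HasSum (fun i => dualSeq w i * parkMatrix i j) (μ * dualSeq w j) := by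
  rw [dualSeq_apply, ← hw, parkOp_unitVec]
  exact hasSum_functional w (parkCol j)

theorem exists_ellOne_of_summable_norm {x : ℕ → ℂ} (hx : Summable fun j => ‖x j‖) :
    ∃ a b : EllOne, ∀ j, x j = ⟨a j, b j⟩ := by
  have hmem : ∀ f : ℕ → ℝ, (∀ j, |f j| ≤ ‖x j‖) → Memℓp f 1 := fun f hf =>
    (memℓp_gen_iff (p := 1) (by simp)).2 <| by
      simpa using Summable.of_nonneg_of_le (fun _ => abs_nonneg _) hf hx
  exact ⟨⟨_, hmem _ fun j => Complex.abs_re_le_norm (x j)⟩,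
    ⟨_, hmem _ fun j => Complex.abs_im_le_norm (x j)⟩, fun _ => rfl⟩

theorem IsComplexEigen.exists_re_im {z : ℂ} {x : ℕ → ℂ} (h : IsComplexEigen z x) :
    ∃ a b : EllOne, (a ≠ 0 ∨ b ≠ 0) ∧ parkOp a = z.re • a - z.im • b ∧
      parkOp b = z.im • a + z.re • b := by
  obtain ⟨hx₀, hx, hsum⟩ := h
  obtain ⟨a, b, hab⟩ := exists_ellOne_of_summable_norm hx
  refine ⟨a, b, ?_, ?_, ?_⟩
  · by_contra! hzero
    exact hx₀ (funext fun j => by rw [hab, hzero.1, hzero.2]; rfl)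
  · ext i
    change parkOp a i = z.re * a i - z.im * b i
    refine (parkOp_hasSum a i).unique ?_
    simpa [hab] using (hsum i).mapL Complex.reCLM
  · ext i
    change parkOp b i = z.im * a i + z.re * b i
    refine (parkOp_hasSum b i).unique ?_
    simpa [hab, add_comm] using (hsum i).mapL Complex.imCLM

end PrincipalEigenvectors

theorem mainTheorem4_general :
    (∀ m : ℕ, 4 ≤ m →
      ∃! t : ℝ × (Fin (m + 1) → ℝ) × (Fin (m + 1) → ℝ),
        IsPrincipalTriple m t.1 t.2.1 t.2.2) ∧
    ∀ (lamSeq : ℕ → ℝ) (vSeq wSeq : (m : ℕ) → Fin (m + 1) → ℝ),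
      (∀ᶠ m in atTop, IsPrincipalTriple m (lamSeq m) (vSeq m) (wSeq m)) →
      ∃ (lam : ℝ) (v : EllOne) (w : EllInf),
        Tendsto lamSeq atTop (𝓝 lam) ∧
        Tendsto (fun m => padZero 1 (vSeq m)) atTop (𝓝 v) ∧
        Tendsto (fun m => padZero ∞ (wSeq m)) atTop (𝓝 w) ∧
        0 < lam ∧
        parkOp v = lam • v ∧
        (∀ j : ℕ, HasSum (fun i => w i * parkMatrix i j) (lam * w j)) ∧
        (∀ (z : ℂ) (x : ℕ → ℂ), IsComplexEigen z x → z ≠ (lam : ℂ) → ‖z‖ < lam) ∧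
        0 < rowMul w v ∧
        ∀ u : EllOne,
          Tendsto (fun n : ℕ => (lam ^ n)⁻¹ • (parkOp ^ n) u) atTop
            (𝓝 ((rowMul w u / rowMul w v) • v)) ∧
          (rowMul w u ≠ 0 →
            Tendsto (fun n : ℕ => ‖(parkOp ^ n) u‖⁻¹ • (parkOp ^ n) u) atTop
              (𝓝 (‖rowMul w u • v‖⁻¹ • (rowMul w u • v)))) := by
  refine ⟨fun m hm => existsUnique_isPrincipalTriple hm, fun lamSeq vSeq wSeq hseq => ?_⟩
  obtain ⟨μ, v, w, h⟩ := parkFrame_contracts_parkOp.exists_isPrincipal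
  have hgap := h.hasSpectralGap parkFrame_contracts_parkOp
  obtain ⟨hlam, hv, hw⟩ := tendsto_of_isPrincipalTriple h hseq
  have hv₀ : (v 0)⁻¹ < 0 := inv_lt_zero.2 (right_zero_neg h parkOp_apply_zero)
  have hw₀ : (w (unitVec 0))⁻¹ < 0 :=
    inv_lt_zero.2 (left_zero_neg h parkFrame_contracts_parkOp (parkOp_unitVec 1))
  set v' := (v 0)⁻¹ • v
  set w' := (w (unitVec 0))⁻¹ • w with hw'
  have hright : parkOp v' = μ • v' := by rw [map_smul, h.right_eigen, smul_comm]
  have hleft : ∀ x, w' (parkOp x) = μ * w' x := fun x => by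
    rw [hw', smul_apply, smul_apply, h.left_eigen, smul_eq_mul, smul_eq_mul, mul_left_comm]
  have hpair : 0 < w' v' := by
    rw [hw', smul_apply, map_smul, h.pairing, smul_eq_mul, smul_eq_mul, mul_one]
    exact mul_pos_of_neg_of_neg hw₀ hv₀
  refine ⟨μ, v', dualSeq w', hlam, hv, hw, h.eigenvalue_pos, hright,
    hasSum_dualSeq_mul_parkMatrix hleft, fun z x hx hz => ?_, ?_⟩
  · obtain ⟨a, b, hab, ha, hb⟩ := hx.exists_re_im
    exact (hgap.norm_le_of_complex_eigen hab ha hb hz).trans_lt hgap.rate_lt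
  · simp only [rowMul_dualSeq]
    exact ⟨hpair, fun u => ⟨hgap.tendsto_pow_apply_of_eigenvectors hright hleft hpair.ne' u,
      hgap.tendsto_normalize_pow_apply hright hleft hpair⟩⟩

theorem mainTheorem4 :
    -- the truncations have well-defined principal eigenvalues and eigenvectors
    (∀ m : ℕ, 7 ≤ m →
      ∃! t : ℝ × (Fin (m + 1) → ℝ) × (Fin (m + 1) → ℝ),
        IsPrincipalTriple m t.1 t.2.1 t.2.2) ∧
    ∀ (lamSeq : ℕ → ℝ) (vSeq wSeq : (m : ℕ) → Fin (m + 1) → ℝ),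
      (∀ m : ℕ, 7 ≤ m → IsPrincipalTriple m (lamSeq m) (vSeq m) (wSeq m)) →
      ∃ (lam : ℝ) (v : EllOne) (w : EllInf),
        -- `lam`, `v`, `w` are the limits
        Tendsto lamSeq atTop (𝓝 lam) ∧
        Tendsto (fun m => padZero 1 (vSeq m)) atTop (𝓝 v) ∧
        Tendsto (fun m => padZero ∞ (wSeq m)) atTop (𝓝 w) ∧
        -- `lam` is the dominant eigenvalue of the operator, with eigenvectors `v` and `w`
        0 < lam ∧
        parkOp v = lam • v ∧
        (∀ j : ℕ, HasSum (fun i => w i * parkMatrix i j) (lam * w j)) ∧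
        (∀ (z : ℂ) (x : ℕ → ℂ), IsComplexEigen z x → z ≠ (lam : ℂ) → ‖z‖ < lam) ∧
        rowMul w v ≠ 0 ∧
        -- convergence of the iterates in `ℓ¹`
        ∀ u : EllOne, rowMul w u ≠ 0 →
          Tendsto (fun n : ℕ => (lam ^ n)⁻¹ • (parkOp ^ n) u) atTop
            (𝓝 ((rowMul w u / rowMul w v) • v)) ∧
          Tendsto (fun n : ℕ => ‖(parkOp ^ n) u‖⁻¹ • (parkOp ^ n) u) atTop
            (𝓝 (‖rowMul w u • v‖⁻¹ • (rowMul w u • v))) := by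
  refine ⟨fun m hm => mainTheorem4_general.1 m (by omega), fun lamSeq vSeq wSeq hseq => ?_⟩
  obtain ⟨lam, v, w, hlam, hv, hw, hpos, hright, hleft, hdom, hpair, hlim⟩ :=
    mainTheorem4_general.2 lamSeq vSeq wSeq (eventually_atTop.2 ⟨7, hseq⟩)
  exact ⟨lam, v, w, hlam, hv, hw, hpos, hright, hleft, hdom, hpair.ne',
    fun u hu => ⟨(hlim u).1, (hlim u).2 hu⟩⟩
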